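/- Let $L$ be a homogeneous L\'evy basis on $\mathbb{R}\times\mathbb{R}$ with characteristic triplet $(\zeta,a,\nu)$: a family of real random variables $L(A)$, indexed by the bounded Borel sets $A\subseteq\mathbb{R}^2$, which is a.s. countably additive, independently scattered (values on disjoint sets are independent) and infinitely divisible, with \[ \mathbb{E}\,e^{i\theta L(A)}=\exp\Big(\mathrm{Leb}(A)\Big[i\theta\zeta-\tfrac12\theta^2a+\int_{\mathbb{R}}\big(e^{i\theta\xi}-1-i\theta\xi\mathbb{I}_{[-1,1]}(\xi)\big)\nu(d\xi)\Big]\Big),\qquad \theta\in\mathbb{R}, \] where $\zeta\in\mathbb{R}$, $a\ge 0$ and $\nu$ is a L\'evy measure. Let $L'$ be the associated L\'evy seed, i.e. a random variable whose characteristic function is given by the same formula with $\mathrm{Leb}(A)$ replaced by $1$. Let $f:\mathbb{R}\times\mathbb{R}\to\mathbb{R}$, and let $Y=(Y_t)_{t\in\mathbb{R}}$ be the mixed moving average process \[ Y_t=\int_{\mathbb{R}\times\mathbb{R}}f(x,t-s)\,L(dx,ds), \] the integral being that of Rajput and Rosi\'nski (the limit in probability of the integrals of simple functions with bounded support that converge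 to the integrand almost everywhere and whose integrals over every Borel set converge in probability). Suppose that $L'$ is non-zero (not a.s. equal to $0$), that $\mathbb{E}(L')=0$ and $\mathbb{E}(L'^4)<\infty$, and that $f\in L^2(\mathbb{R}\times\mathbb{R})\cap L^4(\mathbb{R}\times\mathbb{R})$. Put $\kappa_2:=\mathbb{E}(L'^2)=\mathrm{Var}(L')$, $\eta:=\mathbb{E}(L'^4)/\kappa_2^2$, $\kappa_4:=(\eta-3)\kappa_2^2$ and $\gamma(h):=\mathrm{Cov}(Y_0,Y_h)$ for $h\in\mathbb{R}$. Then $\mathbb{E}(Y_t^4)<\infty$ for all $t\in\mathbb{R}$, \[ \gamma(h)=\kappa_2\int_{\mathbb{R}\times\mathbb{R}}f(x,-s)f(x,h-s)\,dx\,ds\qquad\text{for all }h\in\mathbb{R}, \] and for all $t_1,t_2,t_3,t_4\in\mathbb{R}$ the product $Y_{t_1}Y_{t_2}Y_{t_3}Y_{t_4}$ is integrable with \[ \begin{aligned} \mathbb{E}(Y_{t_1}Y_{t_2}Y_{t_3}Y_{t_4}) ={}&\gamma(t_1-t_2)\gamma(t_3-t_4)+\gamma(t_1-t_3)\gamma(t_2-t_4)+\gamma(t_1-t_4)\gamma(t_2-t_3)\\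 &+\kappa_4\int_{\mathbb{R}\times\mathbb{R}}f(x,t_1-t_3+s)\,f(x,t_2-t_3+s)\,f(x,s)\,f(x,t_4-t_3+s)\,dx\,ds. \end{aligned} \] -/

import Mathlib

open MeasureTheory ProbabilityTheory Filter Topology

/-- A probability measure on `ℝ` is infinitely divisible if for every `n ≥ 1` it is the law of the
sum of `n` independent random variables with a common law. -/
def IsInfDivisible (μ : Measure ℝ) : Prop :=
  ∀ n : ℕ, 1 ≤ n → ∃ ρ : Measure ℝ, IsProbabilityMeasure ρ ∧
    μ = (Measure.pi (fun _ : Fin n => ρ)).map (fun x => ∑ i, x i)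

/-- A Lévy measure on `ℝ`: no mass at the origin, and `min (1, ξ²)` is integrable. -/
def IsLevyMeasure (ν : Measure ℝ) : Prop :=
  ν {0} = 0 ∧ ∫⁻ ξ, ENNReal.ofReal (min 1 (ξ ^ 2)) ∂ν < ⊤

/-- The Lévy–Khintchine exponent of the triplet `(ζ, a, ν)` with truncation function
`𝟙_{[-1,1]}`:
`iθζ - θ² a / 2 + ∫ (exp (iθξ) - 1 - iθξ 𝟙_{[-1,1]}(ξ)) ν(dξ)`. -/
noncomputable def levyExponent (ζ a : ℝ) (ν : Measure ℝ) (θ : ℝ) : ℂ :=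
  Complex.I * θ * ζ - (1 / 2) * (θ : ℂ) ^ 2 * a +
    ∫ ξ : ℝ, (Complex.exp (Complex.I * θ * ξ) - 1 -
      Complex.I * θ * ((Set.Icc (-1 : ℝ) 1).indicator (fun y : ℝ => y) ξ : ℝ)) ∂ν

/-- A real-valued Lévy basis on `ℝ × ℝ`, indexed by the bounded Borel sets (the values of `L` on
other sets are irrelevant): an independently scattered random measure, countably additive
almost surely, with infinitely divisible laws. -/
structure IsLevyBasis {Ω : Type*} [MeasurableSpace Ω] (P : Measure Ω)
    (L : Set (ℝ × ℝ) → Ω → ℝ) : Prop where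
  measurable : ∀ A, MeasurableSet A → Bornology.IsBounded A → Measurable (L A)
  additive : ∀ A : ℕ → Set (ℝ × ℝ), (∀ j, MeasurableSet (A j)) →
    Pairwise (Function.onFun Disjoint A) → Bornology.IsBounded (⋃ j, A j) →
    ∀ᵐ ω ∂P, Tendsto (fun n => ∑ j ∈ Finset.range n, L (A j) ω) atTop (𝓝 (L (⋃ j, A j) ω))
  indep : ∀ A : ℕ → Set (ℝ × ℝ), (∀ j, MeasurableSet (A j)) →
    (∀ j, Bornology.IsBounded (A j)) → Pairwise (Function.onFun Disjoint A) →
    iIndepFun (fun j => L (A j)) P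
  infDiv : ∀ A, MeasurableSet A → Bornology.IsBounded A → IsInfDivisible (P.map (L A))

/-- A homogeneous Lévy basis on `ℝ × ℝ` with characteristic triplet `(ζ, a, ν)`: the cumulant
function of `L A` is `Leb(A)` times the Lévy–Khintchine exponent. The exponent is continuous in
`θ` and vanishes at `0`, so the exponential form below says exactly that it is the distinguished
logarithm of the characteristic function. -/
structure IsHomogeneousLevyBasis {Ω : Type*} [MeasurableSpace Ω] (P : Measure Ω)
    (L : Set (ℝ × ℝ) → Ω → ℝ) (ζ a : ℝ) (ν : Measure ℝ) : Prop
    extends IsLevyBasis P L where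
  a_nonneg : 0 ≤ a
  levyMeasure : IsLevyMeasure ν
  charFun_eq : ∀ A, MeasurableSet A → Bornology.IsBounded A → ∀ θ : ℝ,
    charFun (P.map (L A)) θ = Complex.exp ((volume A).toReal * levyExponent ζ a ν θ)

/-- A Lévy seed with characteristic triplet `(ζ, a, ν)`: a random variable with that
Lévy–Khintchine exponent as cumulant function. -/
structure IsLevySeed {Ω : Type*} [MeasurableSpace Ω] (P : Measure Ω) (X : Ω → ℝ)
    (ζ a : ℝ) (ν : Measure ℝ) : Prop where
  measurable : Measurable X
  charFun_eq : ∀ θ : ℝ, charFun (P.map X) θ = Complex.exp (levyExponent ζ a ν θ)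

/-- The elementary integral `∫_A φ dL = ∑ y, y L({φ = y} ∩ A)` of a simple function with bounded
support. The value `y = 0` contributes nothing. -/
noncomputable def simpleStochInt {Ω : Type*} (L : Set (ℝ × ℝ) → Ω → ℝ)
    (φ : SimpleFunc (ℝ × ℝ) ℝ) (A : Set (ℝ × ℝ)) (ω : Ω) : ℝ :=
  ∑ y ∈ φ.range, y * L (φ ⁻¹' {y} ∩ A) ω

/-- `X = ∫ g dL` in the sense of Rajput and Rosiński: there are simple functions `φ n` with
bounded support such that `φ n → g` Lebesgue-almost everywhere, the integrals `∫_A φ n dL` converge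
in probability for every Borel set `A`, and `X` is the limit in probability of the integrals over
the whole space. -/
def IsStochInt {Ω : Type*} [MeasurableSpace Ω] (P : Measure Ω) (L : Set (ℝ × ℝ) → Ω → ℝ)
    (g : ℝ × ℝ → ℝ) (X : Ω → ℝ) : Prop :=
  ∃ φ : ℕ → SimpleFunc (ℝ × ℝ) ℝ,
    (∀ n, Bornology.IsBounded (Function.support (φ n))) ∧
    (∀ᵐ z, Tendsto (fun n => φ n z) atTop (𝓝 (g z))) ∧
    (∀ A, MeasurableSet A → ∃ Z : Ω → ℝ,
      TendstoInMeasure P (fun n => simpleStochInt L (φ n) A) atTop Z) ∧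
    TendstoInMeasure P (fun n => simpleStochInt L (φ n) Set.univ) atTop X

/-- `Y` is the mixed moving average process `Y_t = ∫ f (x, t - s) L(dx, ds)`, `t ∈ ℝ`. -/
def IsMMAP {Ω : Type*} [MeasurableSpace Ω] (P : Measure Ω) (L : Set (ℝ × ℝ) → Ω → ℝ)
    (f : ℝ × ℝ → ℝ) (Y : ℝ → Ω → ℝ) : Prop :=
  ∀ t : ℝ, IsStochInt P L (fun z => f (z.1, t - z.2)) (Y t)

/-! Everything follows from one identity: if `X = ∫ g dL` with `g` in `L² ∩ L⁴`, then `E X = 0`, `E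
X² = κ₂ ∫ g²` and `E X⁴ = 3 (κ₂ ∫ g²)² + κ₄ ∫ g⁴` (`IsLevyBasis.moments_of_isStochInt`). Since the
integral is linear, the identity also holds for every signed sum of the four variables. Polarizing
it turns the squared quadratic form into the three pairings of covariances, and `∫ g⁴` into the
integral of the product of the four kernels. Reflections and shifts in time then give the stated
form.

For a single set the identity comes from the convolution semigroup with characteristic functions
`exp (v ψ)`, without differentiating the exponent. Mean, variance and fourth cumulant are additive
in `v`. The variance is nonnegative, hence linear. The cumulant is nonnegative too, because it is
`n` times its value at `v / n`, where the negative part is only of order `n⁻²`. The mean has no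
sign; it vanishes at rational times, and the characteristic function near time zero excludes any
other value (`mean_eq_zero_of_charFun_eq_exp`). Independence carries the identity to simple
functions, and completeness of `L⁴(P)` to limits of dominated simple functions.

The integral, however, is defined through an arbitrary sequence converging almost everywhere, with
no domination. That it agrees with the `L⁴` limit is the content of
`IsLevyBasis.ae_eq_zero_of_tendstoInMeasure`, a gliding hump argument: one Borel set is built that
carries almost all the `L²` mass of the functions along one subsequence and almost none along
another, so convergence over this set forces the limit to be zero. -/

/-- A nonnegative solution of Cauchy's functional equation on `[0, ∞)` is linear. -/
theorem eq_mul_of_additive_of_nonneg {g : ℝ → ℝ}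
    (hadd : ∀ v w, 0 ≤ v → 0 ≤ w → g (v + w) = g v + g w) (hg : ∀ v, 0 ≤ v → 0 ≤ g v)
    {v : ℝ} (hv : 0 ≤ v) : g v = v * g 1 := by
  have hmono : ∀ x y, 0 ≤ x → x ≤ y → g x ≤ g y := by
    intro x y hx hxy
    have h := hadd x (y - x) hx (sub_nonneg.2 hxy)
    rw [add_sub_cancel] at h
    linarith [hg (y - x) (sub_nonneg.2 hxy)]
  have hnsmul : ∀ (n : ℕ) x, 0 ≤ x → g (n * x) = n * g x := by
    intro n x hx
    induction n with
    | zero =>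
      have h := hadd 0 0 le_rfl le_rfl
      simp only [add_zero] at h
      simp; linarith
    | succ n ih =>
      push_cast
      rw [add_mul, one_mul, hadd _ _ (by positivity) hx, ih]
      ring
  have hone : ∀ n : ℕ, g n = n * g 1 := fun n => by
    simpa using hnsmul n 1 zero_le_one
  -- With `k = ⌊n v⌋`, monotonicity squeezes both `n * g v` and `n * v * g 1` between `k * g 1` and
  -- `(k + 1) * g 1`.
  have hbound : ∀ n : ℕ, |(g v - v * g 1)| * n ≤ g 1 := by
    intro n
    have h1 := Nat.floor_le (show (0 : ℝ) ≤ n * v by positivity)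
    have h2 := (Nat.lt_floor_add_one ((n : ℝ) * v)).le
    have h3 := hmono _ _ (Nat.cast_nonneg _) h1
    have h4 := hmono _ _ (by positivity) h2
    rw [hone, hnsmul _ _ hv] at h3
    have h5 := hone (⌊(n : ℝ) * v⌋₊ + 1)
    push_cast at h5
    rw [h5, hnsmul _ _ hv] at h4
    have h6 := hg 1 zero_le_one
    rw [← abs_of_nonneg (Nat.cast_nonneg (α := ℝ) n), ← abs_mul, abs_le]
    constructor <;> nlinarith
  by_contra hne
  have hpos : 0 < |g v - v * g 1| := abs_pos.2 (sub_ne_zero.2 hne)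
  obtain ⟨n, hn⟩ := exists_nat_gt (g 1 / |g v - v * g 1|)
  rw [div_lt_iff₀ hpos] at hn
  linarith [hbound n, mul_comm (n : ℝ) |g v - v * g 1|]

/-! ### Fourth moments, independence and convolution -/

theorem memLp_four_iff_integrable_pow {Ω : Type*} [MeasurableSpace Ω] {P : Measure Ω} {X : Ω → ℝ}
    (hX : AEStronglyMeasurable X P) : MemLp X 4 P ↔ Integrable (fun ω => X ω ^ 4) P := by
  rw [← integrable_norm_rpow_iff hX (by norm_num) (by norm_num)]
  refine integrable_congr (.of_forall fun ω => ?_)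
  have : (4 : ENNReal).toReal = (4 : ℕ) := by norm_num
  simp only [this, Real.rpow_natCast, Real.norm_eq_abs]
  exact (by decide : Even 4).pow_abs _

theorem MeasureTheory.MemLp.integrable_pow_of_le_four {Ω : Type*} [MeasurableSpace Ω]
    {P : Measure Ω} [IsFiniteMeasure P] {X : Ω → ℝ} (hX : MemLp X 4 P) {k : ℕ} (hk : k ≤ 4) :
    Integrable (fun ω => X ω ^ k) P := by
  rcases Nat.eq_zero_or_pos k with rfl | hk0
  · simp
  have h : MemLp X (k : ENNReal) P := hX.mono_exponent (by exact_mod_cast hk)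
  refine (integrable_norm_iff (hX.1.pow k)).1 ?_
  simpa [norm_pow] using h.integrable_norm_pow hk0.ne'

/-- The first, second and fourth moments of a sum of two independent centred random variables. -/
theorem ProbabilityTheory.IndepFun.moments_add {Ω : Type*} [MeasurableSpace Ω] {P : Measure Ω}
    [IsProbabilityMeasure P] {S T : Ω → ℝ} (hST : IndepFun S T P) (hS : MemLp S 4 P)
    (hT : MemLp T 4 P) (hS0 : ∫ ω, S ω ∂P = 0) (hT0 : ∫ ω, T ω ∂P = 0) :
    ∫ ω, (S ω + T ω) ∂P = 0 ∧
    ∫ ω, (S ω + T ω) ^ 2 ∂P = ∫ ω, S ω ^ 2 ∂P + ∫ ω, T ω ^ 2 ∂P ∧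
    ∫ ω, (S ω + T ω) ^ 4 ∂P = ∫ ω, S ω ^ 4 ∂P +
      6 * (∫ ω, S ω ^ 2 ∂P) * (∫ ω, T ω ^ 2 ∂P) + ∫ ω, T ω ^ 4 ∂P := by
  have hSi : ∀ {k : ℕ}, k ≤ 4 → Integrable (fun ω => S ω ^ k) P := hS.integrable_pow_of_le_four
  have hTi : ∀ {k : ℕ}, k ≤ 4 → Integrable (fun ω => T ω ^ k) P := hT.integrable_pow_of_le_four
  have hind : ∀ k l : ℕ, IndepFun (fun ω => S ω ^ k) (fun ω => T ω ^ l) P := fun k l =>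
    hST.comp (φ := fun x => x ^ k) (ψ := fun x => x ^ l) (by fun_prop) (by fun_prop)
  have hmulI : ∀ {k l : ℕ}, k ≤ 4 → l ≤ 4 → Integrable (fun ω => S ω ^ k * T ω ^ l) P :=
    fun {k l} hk hl => (hind k l).integrable_mul (hSi hk) (hTi hl)
  have hmul : ∀ {k l : ℕ}, k ≤ 4 → l ≤ 4 → ∫ ω, S ω ^ k * T ω ^ l ∂P =
      (∫ ω, S ω ^ k ∂P) * ∫ ω, T ω ^ l ∂P :=
    fun {k l} hk hl => (hind k l).integral_fun_mul_eq_mul_integral (hSi hk).1 (hTi hl).1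
  have hS1 : ∫ ω, S ω ^ 1 ∂P = 0 := by simpa using hS0
  have hT1 : ∫ ω, T ω ^ 1 ∂P = 0 := by simpa using hT0
  refine ⟨?_, ?_, ?_⟩
  · rw [integral_add (by simpa using hSi (k := 1) (by norm_num))
      (by simpa using hTi (k := 1) (by norm_num)), hS0, hT0, add_zero]
  · have h : ∀ ω, (S ω + T ω) ^ 2 = S ω ^ 2 + 2 * (S ω ^ 1 * T ω ^ 1) + T ω ^ 2 :=
      fun ω => by ring
    simp_rw [h]
    have i2 := hSi (k := 2) (by norm_num)
    have i11 := (hmulI (k := 1) (l := 1) (by norm_num) (by norm_num)).const_mul 2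
    rw [integral_add (i2.fun_add i11) (hTi (by norm_num)), integral_add i2 i11,
      integral_const_mul, hmul (by norm_num) (by norm_num), hS1]
    ring
  -- The terms of type (3,1) and (1,3) contain a first moment and vanish.
  · have h : ∀ ω, (S ω + T ω) ^ 4 = S ω ^ 4 + 4 * (S ω ^ 3 * T ω ^ 1) + 6 * (S ω ^ 2 * T ω ^ 2) +
        4 * (S ω ^ 1 * T ω ^ 3) + T ω ^ 4 := fun ω => by ring
    simp_rw [h]
    have i4 := hSi (k := 4) (by norm_num)
    have i31 := (hmulI (k := 3) (l := 1) (by norm_num) (by norm_num)).const_mul 4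
    have i22 := (hmulI (k := 2) (l := 2) (by norm_num) (by norm_num)).const_mul 6
    have i13 := (hmulI (k := 1) (l := 3) (by norm_num) (by norm_num)).const_mul 4
    rw [integral_add (((i4.fun_add i31).fun_add i22).fun_add i13) (hTi (by norm_num)),
      integral_add ((i4.fun_add i31).fun_add i22) i13, integral_add (i4.fun_add i31) i22,
      integral_add i4 i31, integral_const_mul, integral_const_mul, integral_const_mul,
      hmul (by norm_num) (by norm_num), hmul (by norm_num) (by norm_num),
      hmul (by norm_num) (by norm_num), hS1, hT1]
    ring

-- By Fubini, `y ↦ (x + y) ^ 4` is integrable for almost every `x`; one such `x` suffices, since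
-- subtracting a constant preserves `L⁴`.
open scoped MeasureTheory in
theorem memLp_id_of_conv {μ ν : Measure ℝ} [IsProbabilityMeasure μ] [IsProbabilityMeasure ν]
    (h : MemLp id 4 (μ ∗ ν)) : MemLp id 4 ν := by
  have h' := (memLp_four_iff_integrable_pow h.1).1 h
  rw [integrable_conv_iff (by fun_prop)] at h'
  obtain ⟨x, hx⟩ := h'.1.exists
  have h1 : MemLp (fun y => x + y) 4 ν := (memLp_four_iff_integrable_pow (by fun_prop)).2 hx
  have h2 := h1.sub (memLp_const x)
  convert h2 using 1
  ext y; simp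

open scoped MeasureTheory in
theorem memLp_id_conv {μ ν : Measure ℝ} [IsProbabilityMeasure μ] [IsProbabilityMeasure ν]
    (hμ : MemLp id 4 μ) (hν : MemLp id 4 ν) : MemLp id 4 (μ ∗ ν) := by
  rw [Measure.conv, memLp_map_measure_iff (by fun_prop) (by fun_prop)]
  exact (hμ.comp_fst ν).add (hν.comp_snd μ)

/-! ### Moments of convolution semigroups -/

/-- `μ` is centred with finite fourth moment, variance `κ₂ v` and fourth cumulant `κ₄ v`, as is the
time-`v` law of a convolution semigroup. -/
structure HasSemigroupMoments (μ : Measure ℝ) (v κ₂ κ₄ : ℝ) : Prop where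
  memLp : MemLp id 4 μ
  mean : ∫ x, x ∂μ = 0
  sq : ∫ x, x ^ 2 ∂μ = κ₂ * v
  fourth : ∫ x, x ^ 4 ∂μ = 3 * (κ₂ * v) ^ 2 + κ₄ * v

section Semigroup

open scoped MeasureTheory

variable {μ : ℝ → Measure ℝ} [∀ v, IsProbabilityMeasure (μ v)]

/-- Integer times are reached by repeated convolution; any other time law is a convolution factor of
a later integer time law, and factors inherit the fourth moment. -/
theorem memLp_of_convolution_semigroup (hconv : ∀ v w, 0 ≤ v → 0 ≤ w → μ (v + w) = μ v ∗ μ w)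
    (h1 : MemLp id 4 (μ 1)) {v : ℝ} (hv : 0 ≤ v) : MemLp id 4 (μ v) := by
  have hnat : ∀ n : ℕ, MemLp id 4 (μ (n + 1)) := by
    intro n
    induction n with
    | zero => simpa using h1
    | succ n ih =>
      push_cast
      rw [hconv _ _ (by positivity) zero_le_one]
      exact memLp_id_conv ih h1
  obtain ⟨n, hn⟩ := exists_nat_ge v
  have h := hnat n
  rw [show (n : ℝ) + 1 = (n + 1 - v) + v by ring, hconv _ _ (by linarith) hv] at h
  exact memLp_id_of_conv h

theorem integral_id_conv {α β : Measure ℝ} [IsProbabilityMeasure α] [IsProbabilityMeasure β]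
    (hα : MemLp id 4 α) (hβ : MemLp id 4 β) :
    ∫ x, x ∂(α ∗ β) = ∫ x, x ∂α + ∫ x, x ∂β := by
  have hi : ∀ {α : Measure ℝ} [IsProbabilityMeasure α], MemLp id 4 α → Integrable (fun x => x) α :=
    fun h => h.integrable (by norm_num)
  rw [integral_conv (hi (memLp_id_conv hα hβ))]
  have : ∀ x, ∫ y, (x + y) ∂β = x + ∫ y, y ∂β := fun x => by
    rw [integral_add (integrable_const x) (hi hβ)]; simp
  simp_rw [this]
  rw [integral_add (hi hα) (integrable_const _)]
  simp

theorem variance_id_conv {α β : Measure ℝ} [IsProbabilityMeasure α] [IsProbabilityMeasure β]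
    (hα : MemLp id 4 α) (hβ : MemLp id 4 β) :
    Var[id; α ∗ β] = Var[id; α] + Var[id; β] := by
  have h1 : Var[id; α ∗ β] = Var[(fun p : ℝ × ℝ => p.1) + (fun p => p.2); α.prod β] := by
    rw [Measure.conv, variance_map (by fun_prop) (by fun_prop)]
    rfl
  have hind : IndepFun (fun p : ℝ × ℝ => p.1) (fun p => p.2) (α.prod β) :=
    indepFun_prod (X := id) (Y := id) measurable_id measurable_id
  have hα' : MemLp (fun p : ℝ × ℝ => p.1) 2 (α.prod β) :=
    (hα.mono_exponent (by norm_num)).comp_fst β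
  have hβ' : MemLp (fun p : ℝ × ℝ => p.2) 2 (α.prod β) :=
    (hβ.mono_exponent (by norm_num)).comp_snd α
  rw [h1, hind.variance_add hα' hβ']
  congr 1
  · exact (measurePreserving_fst (μ := α) (ν := β)).variance_fun_comp (f := id) (by fun_prop)
  · exact (measurePreserving_snd (μ := α) (ν := β)).variance_fun_comp (f := id) (by fun_prop)

/-- Compare `exp (iθx)` with its value at the mean, using that the exponential is 1-Lipschitz on the
imaginary axis, and bound `E|x - m|` by the standard deviation. When the variance is small, the
characteristic function thus reveals the mean. -/
theorem norm_charFun_sub_exp_le {α : Measure ℝ} [IsProbabilityMeasure α] (hα : MemLp id 4 α)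
    (θ : ℝ) : ‖charFun α θ - Complex.exp (Complex.I * (θ * ∫ x, x ∂α : ℝ))‖ ≤
      |θ| * √(Var[id; α]) := by
  set m := ∫ x, x ∂α with hm
  have hi : Integrable (fun x : ℝ => x) α := hα.integrable (by norm_num)
  have h1 : charFun α θ - Complex.exp (Complex.I * (θ * m : ℝ)) =
      ∫ x : ℝ, (Complex.exp (θ * x * Complex.I) - Complex.exp (Complex.I * (θ * m : ℝ))) ∂α := by
    rw [integral_sub _ (integrable_const _), charFun_apply_real]
    · simp
    · refine Integrable.of_bound (C := 1) (by fun_prop) (.of_forall fun x => ?_)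
      have := Complex.norm_exp_ofReal_mul_I (θ * x)
      push_cast at this
      exact this.le
  have h2 : ∀ x : ℝ, ‖Complex.exp (θ * x * Complex.I) - Complex.exp (Complex.I * (θ * m : ℝ))‖ ≤
      |θ| * |x - m| := by
    intro x
    have : Complex.exp (θ * x * Complex.I) - Complex.exp (Complex.I * (θ * m : ℝ)) =
        Complex.exp (Complex.I * (θ * m : ℝ)) *
          (Complex.exp (Complex.I * (θ * (x - m) : ℝ)) - 1) := by
      rw [mul_sub, ← Complex.exp_add, mul_one]
      congr 2
      push_cast; ring
    rw [this, norm_mul, Complex.norm_exp_I_mul_ofReal, one_mul, ← abs_mul]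
    exact Real.norm_exp_I_mul_ofReal_sub_one_le
  have h3 : ∫ x, |x - m| ∂α ≤ √(Var[id; α]) := by
    apply Real.le_sqrt_of_sq_le
    have hX : MemLp (fun x : ℝ => |x - m|) 2 α :=
      ((hα.mono_exponent (by norm_num)).sub (memLp_const m)).abs
    have := variance_eq_sub hX
    have h0 := variance_nonneg (fun x : ℝ => |x - m|) α
    rw [variance_eq_integral (by fun_prop)]
    simp only [Pi.pow_apply, sq_abs] at this
    simp only [id]
    linarith
  rw [h1]
  refine (norm_integral_le_integral_norm _).trans ?_
  refine (integral_mono_of_nonneg (.of_forall fun _ => norm_nonneg _)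
    ((hi.sub (integrable_const m)).abs.const_mul |θ|) (.of_forall h2)).trans ?_
  rw [integral_const_mul]
  exact mul_le_mul_of_nonneg_left h3 (abs_nonneg θ)

end Semigroup

section Semigroup

open scoped MeasureTheory

variable {μ : ℝ → Measure ℝ} [∀ v, IsProbabilityMeasure (μ v)] {ψ : ℝ → ℂ}

theorem conv_eq_of_charFun_eq_exp
    (hψ : ∀ v, 0 ≤ v → ∀ θ, charFun (μ v) θ = Complex.exp (v * ψ θ))
    {v w : ℝ} (hv : 0 ≤ v) (hw : 0 ≤ w) : μ (v + w) = μ v ∗ μ w := by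
  apply Measure.ext_of_charFun
  ext θ
  rw [charFun_conv, hψ _ (add_nonneg hv hw), hψ v hv, hψ w hw, ← Complex.exp_add]
  congr 1
  push_cast; ring

theorem variance_eq_of_charFun_eq_exp
    (hψ : ∀ v, 0 ≤ v → ∀ θ, charFun (μ v) θ = Complex.exp (v * ψ θ))
    (h1 : MemLp id 4 (μ 1)) {v : ℝ} (hv : 0 ≤ v) : Var[id; μ v] = v * Var[id; μ 1] := by
  have hconv : ∀ v w, 0 ≤ v → 0 ≤ w → μ (v + w) = μ v ∗ μ w :=
    fun v w hv hw => conv_eq_of_charFun_eq_exp hψ hv hw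
  refine eq_mul_of_additive_of_nonneg (g := fun v => Var[id; μ v]) (fun v w hv hw => ?_)
    (fun v _ => variance_nonneg _ _) hv
  rw [hconv v w hv hw, variance_id_conv (memLp_of_convolution_semigroup hconv h1 hv)
    (memLp_of_convolution_semigroup hconv h1 hw)]

/-- Additivity alone admits wild solutions vanishing on the rationals. They are excluded near time
zero: there the characteristic function tends to 1 and the variance to 0, so the mean cannot stay at
a fixed nonzero value. -/
theorem mean_eq_zero_of_charFun_eq_exp
    (hψ : ∀ v, 0 ≤ v → ∀ θ, charFun (μ v) θ = Complex.exp (v * ψ θ))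
    (h1 : MemLp id 4 (μ 1)) (hmean : ∫ x, x ∂(μ 1) = 0) {v : ℝ} (hv : 0 ≤ v) :
    ∫ x, x ∂(μ v) = 0 := by
  have hconv : ∀ v w, 0 ≤ v → 0 ≤ w → μ (v + w) = μ v ∗ μ w :=
    fun v w hv hw => conv_eq_of_charFun_eq_exp hψ hv hw
  have hL : ∀ {v}, 0 ≤ v → MemLp id 4 (μ v) := fun hv => memLp_of_convolution_semigroup hconv h1 hv
  set m : ℝ → ℝ := fun v => ∫ x, x ∂(μ v) with hm
  have hadd : ∀ v w, 0 ≤ v → 0 ≤ w → m (v + w) = m v + m w := fun v w hv hw => by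
    simp only [hm]
    rw [hconv v w hv hw, integral_id_conv (hL hv) (hL hw)]
  have hm0 : m 0 = 0 := by
    have h := hadd 0 0 le_rfl le_rfl
    rw [add_zero] at h
    linarith
  have hnsmul : ∀ (n : ℕ) x, 0 ≤ x → m (n * x) = n * m x := by
    intro n x hx
    induction n with
    | zero => simpa using hm0
    | succ n ih =>
      push_cast
      rw [add_mul, one_mul, hadd _ _ (by positivity) hx, ih]
      ring
  have hnat : ∀ n : ℕ, m n = 0 := fun n => by
    simpa [hmean, hm] using hnsmul n 1 zero_le_one
  have hrat : ∀ r : ℚ, 0 ≤ r → m r = 0 := by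
    intro r hr
    have h := hnsmul r.den r (by exact_mod_cast hr)
    have h2 : (r.den : ℝ) * (r : ℝ) = (r.num.toNat : ℕ) := by
      have h3 := Rat.den_mul_eq_num r
      have h4 : ((r.num.toNat : ℕ) : ℤ) = r.num := Int.toNat_of_nonneg (Rat.num_nonneg.2 hr)
      have h5 : (r.den : ℚ) * r = ((r.num.toNat : ℕ) : ℤ) := by rw [h4]; exact h3
      exact_mod_cast h5
    rw [h2, hnat] at h
    have : (r.den : ℝ) ≠ 0 := by exact_mod_cast r.den_ne_zero
    rcases mul_eq_zero.1 h.symm with h | h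
    · exact absurd h this
    · exact h
  -- Take `u = r - v` with `r` rational just above `v`: since `m r = 0`, additivity gives `m u = -m
  -- v` at arbitrarily small times.
  have hsmall : ∀ n : ℕ, ∃ u : ℝ, 0 ≤ u ∧ u ≤ 1 / ((n : ℝ) + 1) ∧ m u = -m v := by
    intro n
    obtain ⟨r, hr1, hr2⟩ := exists_rat_btwn (show v < v + 1 / ((n : ℝ) + 1) by
      linarith [show (0 : ℝ) < 1 / ((n : ℝ) + 1) by positivity])
    refine ⟨r - v, by linarith, by linarith, ?_⟩
    have h := hadd v (r - v) hv (by linarith)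
    rw [add_sub_cancel, hrat r (by exact_mod_cast hv.trans hr1.le)] at h
    linarith
  choose u hu0 hu1 hum using hsmall
  have hu : Tendsto u atTop (𝓝 0) :=
    squeeze_zero hu0 hu1 tendsto_one_div_add_atTop_nhds_zero_nat
  have hexp : ∀ θ : ℝ, Complex.exp (Complex.I * (θ * (-m v) : ℝ)) = 1 := by
    intro θ
    have t1 : Tendsto (fun n => charFun (μ (u n)) θ) atTop (𝓝 1) := by
      simp_rw [hψ _ (hu0 _)]
      have : Tendsto (fun n => (u n : ℂ) * ψ θ) atTop (𝓝 ((0 : ℝ) * ψ θ)) :=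
        ((Complex.continuous_ofReal.tendsto 0).comp hu).mul_const _
      have h := (Complex.continuous_exp.tendsto _).comp this
      simpa [Function.comp_def] using h
    have t2 : Tendsto (fun n => |θ| * √(Var[id; μ (u n)])) atTop (𝓝 0) := by
      simp_rw [variance_eq_of_charFun_eq_exp hψ h1 (hu0 _)]
      have : Continuous fun x : ℝ => |θ| * √(x * Var[id; μ 1]) := by fun_prop
      simpa [Function.comp_def] using (this.tendsto 0).comp hu
    have t3 := squeeze_zero_norm (fun n => norm_charFun_sub_exp_le (hL (hu0 n)) θ) t2
    have t4 : ∀ n, ∫ x, x ∂(μ (u n)) = -m v := hum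
    simp_rw [t4] at t3
    have t5 := tendsto_nhds_unique t3 (t1.sub_const _)
    exact (sub_eq_zero.1 t5.symm).symm
  by_contra hne
  -- This choice of `θ` makes the exponential equal to `-1`.
  have h := hexp (Real.pi / (-m v))
  have hne' : -m v ≠ 0 := neg_ne_zero.2 hne
  rw [div_mul_cancel₀ _ hne', mul_comm, Complex.exp_pi_mul_I] at h
  norm_num at h

/-- The moments of a convolution semigroup with `v`-th characteristic function `exp (v ψ)`. -/
theorem hasSemigroupMoments_of_charFun_eq_exp
    (hψ : ∀ v, 0 ≤ v → ∀ θ, charFun (μ v) θ = Complex.exp (v * ψ θ))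
    (h1 : MemLp id 4 (μ 1)) (hmean : ∫ x, x ∂(μ 1) = 0) {κ₂ κ₄ : ℝ}
    (hκ₂ : κ₂ = ∫ x, x ^ 2 ∂(μ 1)) (hκ₄ : κ₄ = ∫ x, x ^ 4 ∂(μ 1) - 3 * κ₂ ^ 2) :
    ∀ v, 0 ≤ v → HasSemigroupMoments (μ v) v κ₂ κ₄ := by
  have hconv : ∀ v w, 0 ≤ v → 0 ≤ w → μ (v + w) = μ v ∗ μ w :=
    fun v w hv hw => conv_eq_of_charFun_eq_exp hψ hv hw
  have hL : ∀ {v}, 0 ≤ v → MemLp id 4 (μ v) := fun hv => memLp_of_convolution_semigroup hconv h1 hv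
  have hm : ∀ {v}, 0 ≤ v → ∫ x, x ∂(μ v) = 0 :=
    fun hv => mean_eq_zero_of_charFun_eq_exp hψ h1 hmean hv
  have hsq : ∀ {v}, 0 ≤ v → ∫ x, x ^ 2 ∂(μ v) = κ₂ * v := by
    intro v hv
    have hvar : ∀ {v}, 0 ≤ v → ∫ x, x ^ 2 ∂(μ v) = Var[id; μ v] := fun hv => by
      exact (variance_of_integral_eq_zero (X := id) (by fun_prop) (hm hv)).symm
    rw [hvar hv, variance_eq_of_charFun_eq_exp hψ h1 hv, hκ₂, hvar zero_le_one, mul_comm]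
  -- The fourth cumulant of the time-`v` law: subtracting three times the squared variance cancels
  -- the cross term `6 E S² E T²`.
  set c : ℝ → ℝ := fun v => ∫ x, x ^ 4 ∂(μ v) - 3 * (κ₂ * v) ^ 2 with hc
  have hadd : ∀ v w, 0 ≤ v → 0 ≤ w → c (v + w) = c v + c w := by
    intro v w hv hw
    have hind : IndepFun (fun p : ℝ × ℝ => p.1) (fun p => p.2) ((μ v).prod (μ w)) :=
      indepFun_prod (X := id) (Y := id) measurable_id measurable_id
    have hf : ∀ f : ℝ → ℝ, ∫ p : ℝ × ℝ, f p.1 ∂((μ v).prod (μ w)) = ∫ x, f x ∂(μ v) := fun f => by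
      rw [integral_fun_fst]; simp
    have hs : ∀ f : ℝ → ℝ, ∫ p : ℝ × ℝ, f p.2 ∂((μ v).prod (μ w)) = ∫ x, f x ∂(μ w) := fun f => by
      rw [integral_fun_snd]; simp
    have h := (hind.moments_add ((hL hv).comp_fst _) ((hL hw).comp_snd _)
      ((hf fun x => x).trans (hm hv)) ((hs fun x => x).trans (hm hw))).2.2
    have h' : ∫ x, x ^ 4 ∂(μ (v + w)) = ∫ p : ℝ × ℝ, (p.1 + p.2) ^ 4 ∂((μ v).prod (μ w)) := by
      rw [hconv v w hv hw, Measure.conv, integral_map (by fun_prop) (by fun_prop)]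
    simp only [hc]
    rw [h', h, hf fun x => x ^ 4, hf fun x => x ^ 2, hs fun x => x ^ 4, hs fun x => x ^ 2,
      hsq hv, hsq hw]
    ring
  have hc0 : c 0 = 0 := by
    have h := hadd 0 0 le_rfl le_rfl
    rw [add_zero] at h
    linarith
  have hnsmul : ∀ (n : ℕ) x, 0 ≤ x → c (n * x) = n * c x := by
    intro n x hx
    induction n with
    | zero => simpa using hc0
    | succ n ih =>
      push_cast
      rw [add_mul, one_mul, hadd _ _ (by positivity) hx, ih]
      ring
  have hnonneg : ∀ v, 0 ≤ v → 0 ≤ c v := by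
    intro v hv
    -- The fourth moment at time `v / (n + 1)` is nonnegative, so the cumulant there is at least `-3
    -- (κ₂ v / (n + 1))²`; multiplying by `n + 1` leaves a bound of order `1 / (n + 1)`.
    have hlow : ∀ n : ℕ, -(3 * (κ₂ * v) ^ 2) * (1 / ((n : ℝ) + 1)) ≤ c v := by
      intro n
      have h := hnsmul (n + 1) (v / (n + 1)) (by positivity)
      have hn : (n : ℝ) + 1 ≠ 0 := by positivity
      push_cast at h
      rw [mul_div_cancel₀ _ hn] at h
      have h4 : 0 ≤ ∫ x, x ^ 4 ∂(μ (v / (n + 1))) :=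
        integral_nonneg fun x => (by decide : Even 4).pow_nonneg x
      have h5 : -(3 * (κ₂ * (v / (n + 1))) ^ 2) ≤ c (v / (n + 1)) := by
        simp only [hc]; linarith
      rw [h]
      calc -(3 * (κ₂ * v) ^ 2) * (1 / ((n : ℝ) + 1))
          = (n + 1) * -(3 * (κ₂ * (v / (n + 1))) ^ 2) := by field_simp
        _ ≤ _ := mul_le_mul_of_nonneg_left h5 (by positivity)
    have ht : Tendsto (fun n : ℕ => -(3 * (κ₂ * v) ^ 2) * (1 / ((n : ℝ) + 1))) atTop (𝓝 0) := by
      have h := tendsto_one_div_add_atTop_nhds_zero_nat.const_mul (-(3 * (κ₂ * v) ^ 2))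
      rwa [mul_zero] at h
    exact le_of_tendsto' ht hlow
  have hc1 : c 1 = κ₄ := by simp [hc, hκ₄]
  refine fun v hv => ⟨hL hv, hm hv, hsq hv, ?_⟩
  have h := eq_mul_of_additive_of_nonneg hadd hnonneg hv
  rw [hc1] at h
  simp only [hc] at h
  linarith

end Semigroup

/-- The moments of the values of a homogeneous Lévy basis with centred seed. -/
theorem IsHomogeneousLevyBasis.hasSemigroupMoments {Ω Ω' : Type*} [MeasurableSpace Ω]
    [MeasurableSpace Ω'] {P : Measure Ω} [IsProbabilityMeasure P] {P' : Measure Ω'}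
    [IsProbabilityMeasure P'] {ζ a : ℝ} {ν : Measure ℝ} {L : Set (ℝ × ℝ) → Ω → ℝ}
    (hL : IsHomogeneousLevyBasis P L ζ a ν) {L' : Ω' → ℝ} (hL' : IsLevySeed P' L' ζ a ν)
    (hmean : ∫ ω, L' ω ∂P' = 0) (hfourth : MemLp L' 4 P') {κ₂ κ₄ : ℝ}
    (hκ₂ : κ₂ = ∫ ω, L' ω ^ 2 ∂P') (hκ₄ : κ₄ = ∫ ω, L' ω ^ 4 ∂P' - 3 * κ₂ ^ 2) :
    ∀ A, MeasurableSet A → Bornology.IsBounded A →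
      HasSemigroupMoments (P.map (L A)) (volume A).toReal κ₂ κ₄ := by
  -- Rectangles of area `v` realise every time `v ≥ 0` of the semigroup; the law of `L A` depends on
  -- `A` only through its area.
  set B : ℝ → Set (ℝ × ℝ) := fun v => Set.Ioc 0 v ×ˢ Set.Ioc 0 1 with hB
  have hBm : ∀ v, MeasurableSet (B v) := fun v => measurableSet_Ioc.prod measurableSet_Ioc
  have hBb : ∀ v, Bornology.IsBounded (B v) := fun v =>
    (Metric.isBounded_Ioc 0 v).prod (Metric.isBounded_Ioc 0 1)
  have hBv : ∀ v, 0 ≤ v → (volume (B v)).toReal = v := fun v hv => by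
    rw [hB, Measure.volume_eq_prod, Measure.prod_prod]
    simp [hv]
  set μ : ℝ → Measure ℝ := fun v => P.map (L (B v)) with hμ
  have hμp : ∀ v, IsProbabilityMeasure (μ v) := fun v =>
    Measure.isProbabilityMeasure_map (hL.measurable _ (hBm v) (hBb v)).aemeasurable
  have hψ : ∀ v, 0 ≤ v → ∀ θ, charFun (μ v) θ = Complex.exp (v * levyExponent ζ a ν θ) :=
    fun v hv θ => by rw [hL.charFun_eq _ (hBm v) (hBb v), hBv v hv]
  have hP'p : IsProbabilityMeasure (P'.map L') :=
    Measure.isProbabilityMeasure_map hL'.measurable.aemeasurable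
  have h1 : μ 1 = P'.map L' := by
    apply Measure.ext_of_charFun
    ext θ
    rw [hψ 1 zero_le_one, hL'.charFun_eq, Complex.ofReal_one, one_mul]
  have hmap : ∀ k : ℕ, ∫ x, x ^ k ∂(P'.map L') = ∫ ω, L' ω ^ k ∂P' := fun k =>
    integral_map hL'.measurable.aemeasurable (by fun_prop)
  have hmom := hasSemigroupMoments_of_charFun_eq_exp (κ₂ := κ₂) (κ₄ := κ₄) hψ
    (by rw [h1, memLp_map_measure_iff (by fun_prop) hL'.measurable.aemeasurable]; exact hfourth)
    (by rw [h1, integral_map hL'.measurable.aemeasurable (by fun_prop)]; exact hmean)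
    (by rw [h1, hmap, hκ₂]) (by rw [h1, hmap, hκ₄])
  intro A hA hAb
  have hAp : IsProbabilityMeasure (P.map (L A)) :=
    Measure.isProbabilityMeasure_map (hL.measurable _ hA hAb).aemeasurable
  have : P.map (L A) = μ (volume A).toReal := by
    apply Measure.ext_of_charFun
    ext θ
    rw [hψ _ ENNReal.toReal_nonneg, hL.charFun_eq A hA hAb]
  rw [this]
  exact hmom _ ENNReal.toReal_nonneg

/-! ### Finite additivity and integrals of simple functions -/

namespace IsLevyBasis

variable {Ω : Type*} [MeasurableSpace Ω] {P : Measure Ω} {L : Set (ℝ × ℝ) → Ω → ℝ}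

/-- For the constant sequence `∅` the partial sums `n * L ∅` converge, so their increments `L ∅`
tend to zero. This permits padding finite families with empty sets. -/
theorem ae_empty (hL : IsLevyBasis P L) : L ∅ =ᵐ[P] 0 := by
  have h := hL.additive (fun _ => ∅) (fun _ => .empty) (fun i j _ => by simp [Function.onFun])
    (by simp)
  filter_upwards [h] with ω hω
  simp only [Finset.sum_const, Finset.card_range, nsmul_eq_mul, Set.iUnion_empty] at hω
  have h1 := ((tendsto_add_atTop_iff_nat 1).2 hω).sub hω
  simp only [Nat.cast_add, Nat.cast_one, add_mul, one_mul, add_sub_cancel_left, sub_self] at h1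
  simpa using h1

theorem ae_union (hL : IsLevyBasis P L) {A B : Set (ℝ × ℝ)} (hA : MeasurableSet A)
    (hB : MeasurableSet B) (hAb : Bornology.IsBounded A) (hBb : Bornology.IsBounded B)
    (hAB : Disjoint A B) : L (A ∪ B) =ᵐ[P] L A + L B := by
  set C : ℕ → Set (ℝ × ℝ) := fun n => if n = 0 then A else if n = 1 then B else ∅ with hC
  have hU : ⋃ n, C n = A ∪ B := by
    ext z
    simp only [hC, Set.mem_iUnion, Set.mem_union]
    constructor
    · rintro ⟨n, hn⟩
      split_ifs at hn
      · exact .inl hn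
      · exact .inr hn
      · exact hn.elim
    · rintro (h | h)
      · exact ⟨0, by simpa using h⟩
      · exact ⟨1, by simpa using h⟩
  have h := hL.additive C
    (fun n => by simp only [hC]; split_ifs <;> [exact hA; exact hB; exact .empty])
    (fun i j hij => by
      simp only [Function.onFun, hC]
      split_ifs <;> first | (exfalso; omega) | exact hAB | exact hAB.symm | simp)
    (by rw [hU]; exact hAb.union hBb)
  rw [hU] at h
  filter_upwards [h, hL.ae_empty] with ω hω h0
  refine tendsto_nhds_unique hω (tendsto_const_nhds.congr' ?_)
  filter_upwards [eventually_ge_atTop 2] with n hn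
  obtain ⟨m, rfl⟩ := Nat.exists_eq_add_of_le hn
  rw [Finset.sum_range_add, Finset.sum_range_succ, Finset.sum_range_one]
  rw [Finset.sum_eq_zero (s := Finset.range m)]
  · simp [hC]
  · intro j _
    have h1 : ¬ (2 + j = 0) := by omega
    have h2 : ¬ (2 + j = 1) := by omega
    simp only [hC, h1, h2, if_false]
    exact h0

theorem ae_biUnion (hL : IsLevyBasis P L) {ι : Type*} (s : Finset ι) {A : ι → Set (ℝ × ℝ)}
    (hA : ∀ i ∈ s, MeasurableSet (A i)) (hAb : ∀ i ∈ s, Bornology.IsBounded (A i))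
    (hd : (s : Set ι).PairwiseDisjoint A) :
    L (⋃ i ∈ s, A i) =ᵐ[P] fun ω => ∑ i ∈ s, L (A i) ω := by
  classical
  induction s using Finset.induction_on with
  | empty => simp; exact hL.ae_empty
  | insert i s hi ih =>
    have hsub : ∀ {j}, j ∈ s → j ∈ insert i s := fun h => Finset.mem_insert_of_mem h
    have h1 := ih (fun j hj => hA j (hsub hj)) (fun j hj => hAb j (hsub hj))
      (hd.subset (by simp))
    have h2 := hL.ae_union (A := A i) (B := ⋃ j ∈ s, A j) (hA i (Finset.mem_insert_self _ _))
      (s.measurableSet_biUnion fun j hj => hA j (hsub hj))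
      (hAb i (Finset.mem_insert_self _ _))
      ((Bornology.isBounded_biUnion_finset s).2 fun j hj => hAb j (hsub hj))
      (Set.disjoint_iUnion₂_right.2 fun j hj => hd (by simp) (by simp [hj])
        (fun h => hi (h ▸ hj)))
    rw [Finset.set_biUnion_insert]
    filter_upwards [h1, h2] with ω h1 h2
    rw [h2, Finset.sum_insert hi, Pi.add_apply, h1]

theorem iIndepFun_of_finite (hL : IsLevyBasis P L) {ι : Type*} [Finite ι] {A : ι → Set (ℝ × ℝ)}
    (hA : ∀ i, MeasurableSet (A i)) (hAb : ∀ i, Bornology.IsBounded (A i))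
    (hd : Pairwise (Function.onFun Disjoint A)) : iIndepFun (fun i => L (A i)) P := by
  classical
  obtain ⟨n, ⟨e⟩⟩ := Finite.exists_equiv_fin ι
  set C : ℕ → Set (ℝ × ℝ) := fun j => if h : j < n then A (e.symm ⟨j, h⟩) else ∅ with hC
  have hind := hL.indep C
    (fun j => by simp only [hC]; split_ifs <;> [exact hA _; exact .empty])
    (fun j => by simp only [hC]; split_ifs <;> [exact hAb _; exact Bornology.isBounded_empty])
    (fun i j hij => by
      simp only [Function.onFun, hC]
      split_ifs
      · exact hd (fun h => hij (by simpa using congrArg Fin.val (e.symm.injective h)))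
      all_goals simp)
  have h := hind.precomp (g := fun i => (e i : ℕ))
    (fun i j hij => e.injective (Fin.val_injective hij))
  have hCA : ∀ i, C (e i) = A i := fun i => by simp [hC]
  simpa [Function.comp_def, hCA] using h

/-- Moments of a linear combination of the values on disjoint sets. -/
theorem moments_sum (hL : IsLevyBasis P L) [IsProbabilityMeasure P] {κ₂ κ₄ : ℝ}
    (hmom : ∀ A, MeasurableSet A → Bornology.IsBounded A →
      HasSemigroupMoments (P.map (L A)) (volume A).toReal κ₂ κ₄)
    {ι : Type*} [Finite ι] {A : ι → Set (ℝ × ℝ)}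
    (hA : ∀ i, MeasurableSet (A i)) (hAb : ∀ i, Bornology.IsBounded (A i))
    (hd : Pairwise (Function.onFun Disjoint A)) (c : ι → ℝ) (s : Finset ι) :
    MemLp (fun ω => ∑ i ∈ s, c i * L (A i) ω) 4 P ∧
    ∫ ω, ∑ i ∈ s, c i * L (A i) ω ∂P = 0 ∧
    ∫ ω, (∑ i ∈ s, c i * L (A i) ω) ^ 2 ∂P = κ₂ * ∑ i ∈ s, c i ^ 2 * (volume (A i)).toReal ∧
    ∫ ω, (∑ i ∈ s, c i * L (A i) ω) ^ 4 ∂P =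
      3 * (κ₂ * ∑ i ∈ s, c i ^ 2 * (volume (A i)).toReal) ^ 2 +
        κ₄ * ∑ i ∈ s, c i ^ 4 * (volume (A i)).toReal := by
  classical
  have hm : ∀ i, Measurable (L (A i)) := fun i => hL.measurable _ (hA i) (hAb i)
  have hLp : ∀ i, MemLp (L (A i)) 4 P := fun i =>
    (memLp_map_measure_iff (by fun_prop) (hm i).aemeasurable).1 (hmom _ (hA i) (hAb i)).memLp
  have hmap : ∀ (k : ℕ) i, ∫ ω, L (A i) ω ^ k ∂P = ∫ x, x ^ k ∂(P.map (L (A i))) := fun k i =>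
    (integral_map (hm i).aemeasurable (f := fun x : ℝ => x ^ k) (by fun_prop)).symm
  have hmean : ∀ i, ∫ ω, L (A i) ω ∂P = 0 := fun i => by
    rw [← (hmom _ (hA i) (hAb i)).mean]
    exact (integral_map (hm i).aemeasurable (f := fun x : ℝ => x) (by fun_prop)).symm
  have hind : iIndepFun (fun i ω => c i * L (A i) ω) P :=
    (hL.iIndepFun_of_finite hA hAb hd).comp (fun i x => c i * x) (fun i => by fun_prop)
  induction s using Finset.induction_on with
  | empty => simp
  | insert i s hi ih =>
    obtain ⟨ih1, ih2, ih3, ih4⟩ := ih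
    have hsum : (∑ j ∈ s, fun ω => c j * L (A j) ω) = fun ω => ∑ j ∈ s, c j * L (A j) ω := by
      ext ω; simp
    have hI := (hind.indepFun_finsetSum_of_notMem (fun j => (hm j).const_mul (c j)) hi).symm
    rw [hsum] at hI
    have hS : MemLp (fun ω => c i * L (A i) ω) 4 P := (hLp i).const_mul (c i)
    obtain ⟨h1, h2, h4⟩ := hI.moments_add hS ih1
      (by rw [integral_const_mul, hmean, mul_zero]) ih2
    simp only [Finset.sum_insert hi]
    refine ⟨hS.add ih1, h1, ?_, ?_⟩
    · rw [h2, ih3]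
      simp_rw [mul_pow]
      rw [integral_const_mul, hmap, (hmom _ (hA i) (hAb i)).sq]
      ring
    -- The cross term `6 (κ₂ x) (κ₂ y)` completes `3 (κ₂ x)² + 3 (κ₂ y)²` to `3 (κ₂ (x + y))²`,
    -- while the `κ₄` terms simply add.
    · rw [h4, ih3, ih4]
      simp_rw [mul_pow]
      rw [integral_const_mul, integral_const_mul, hmap, hmap, (hmom _ (hA i) (hAb i)).sq,
        (hmom _ (hA i) (hAb i)).fourth]
      ring

end IsLevyBasis

theorem isBounded_preimage_singleton {φ : ℝ × ℝ → ℝ}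
    (hφ : Bornology.IsBounded (Function.support φ)) {y : ℝ} (hy : y ≠ 0) (A : Set (ℝ × ℝ)) :
    Bornology.IsBounded (φ ⁻¹' {y} ∩ A) :=
  hφ.subset fun z hz => by
    have : φ z = y := hz.1
    simpa [this] using hy

/-- The fibre over `0` may be unbounded, where `L` carries no information, so it is dropped before
any property of `L` is used. -/
theorem simpleStochInt_eq_sum_ne_zero {Ω : Type*} (L : Set (ℝ × ℝ) → Ω → ℝ)
    (φ : SimpleFunc (ℝ × ℝ) ℝ) (A : Set (ℝ × ℝ)) (ω : Ω) :
    simpleStochInt L φ A ω = ∑ y ∈ φ.range with y ≠ 0, y * L (φ ⁻¹' {y} ∩ A) ω := by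
  rw [simpleStochInt, Finset.sum_filter_of_ne]
  intro y _ h
  exact left_ne_zero_of_mul h

theorem MeasureTheory.SimpleFunc.integrable_of_isBounded_support {φ : SimpleFunc (ℝ × ℝ) ℝ}
    (hφ : Bornology.IsBounded (Function.support φ)) : Integrable φ := by
  rw [SimpleFunc.integrable_iff_finMeasSupp, SimpleFunc.finMeasSupp_iff]
  intro y hy
  simpa using (isBounded_preimage_singleton hφ hy Set.univ).measure_lt_top (μ := volume)

theorem setIntegral_simpleFunc_pow {φ : SimpleFunc (ℝ × ℝ) ℝ}
    (hφ : Bornology.IsBounded (Function.support φ)) {A : Set (ℝ × ℝ)} {k : ℕ} (hk : k ≠ 0) :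
    ∫ z in A, φ z ^ k =
      ∑ y ∈ φ.range with y ≠ 0, y ^ k * (volume (φ ⁻¹' {y} ∩ A)).toReal := by
  have hi := (SimpleFunc.integrable_of_isBounded_support hφ).restrict (s := A)
  have h0 : (fun y : ℝ => y ^ k) 0 = 0 := by simp [hk]
  have hmap : Bornology.IsBounded (Function.support (φ.map fun y => y ^ k)) :=
    hφ.subset fun z hz => by
      simp only [SimpleFunc.coe_map, Function.mem_support, Function.comp_apply] at hz ⊢
      exact fun h => hz (by simp [h, hk])
  have h1 := SimpleFunc.map_integral φ (fun y => y ^ k) hi h0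
  rw [SimpleFunc.integral_eq_integral _
    (SimpleFunc.integrable_of_isBounded_support hmap).restrict] at h1
  simp only [SimpleFunc.coe_map, Function.comp_apply, smul_eq_mul] at h1
  rw [h1, Finset.sum_filter_of_ne]
  · refine Finset.sum_congr rfl fun y _ => ?_
    rw [mul_comm, measureReal_def, Measure.restrict_apply (φ.measurableSet_preimage _)]
  · rintro y _ h rfl
    simp [hk] at h

theorem MeasureTheory.SimpleFunc.integrable_pow_of_isBounded_support {φ : SimpleFunc (ℝ × ℝ) ℝ}
    (hφ : Bornology.IsBounded (Function.support φ)) {k : ℕ} (hk : k ≠ 0) :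
    Integrable (fun z => φ z ^ k) :=
  SimpleFunc.integrable_of_isBounded_support (φ := φ.map fun y => y ^ k) (hφ.subset fun z hz => by
    simp only [SimpleFunc.coe_map, Function.mem_support, Function.comp_apply] at hz ⊢
    exact fun h => hz (by simp [h, hk]))

namespace IsLevyBasis

variable {Ω : Type*} [MeasurableSpace Ω] {P : Measure Ω} {L : Set (ℝ × ℝ) → Ω → ℝ}

/-- Moments of the integral of a simple function. -/
theorem moments_simpleStochInt (hL : IsLevyBasis P L) [IsProbabilityMeasure P] {κ₂ κ₄ : ℝ}
    (hmom : ∀ A, MeasurableSet A → Bornology.IsBounded A →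
      HasSemigroupMoments (P.map (L A)) (volume A).toReal κ₂ κ₄)
    {φ : SimpleFunc (ℝ × ℝ) ℝ} (hφ : Bornology.IsBounded (Function.support φ))
    {A : Set (ℝ × ℝ)} (hA : MeasurableSet A) :
    MemLp (simpleStochInt L φ A) 4 P ∧
    ∫ ω, simpleStochInt L φ A ω ∂P = 0 ∧
    ∫ ω, simpleStochInt L φ A ω ^ 2 ∂P = κ₂ * ∫ z in A, φ z ^ 2 ∧
    ∫ ω, simpleStochInt L φ A ω ^ 4 ∂P =
      3 * (κ₂ * ∫ z in A, φ z ^ 2) ^ 2 + κ₄ * ∫ z in A, φ z ^ 4 := by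
  set s := φ.range.filter (· ≠ 0) with hs
  have h := hL.moments_sum hmom (ι := s) (A := fun y => φ ⁻¹' {(y : ℝ)} ∩ A)
    (fun y => (φ.measurableSet_preimage _).inter hA)
    (fun y => isBounded_preimage_singleton hφ (Finset.mem_filter.1 y.2).2 A)
    (fun x y hxy => by
      refine Set.disjoint_left.2 fun z hx hy => hxy (Subtype.ext ?_)
      exact (show φ z = x from hx.1).symm.trans hy.1)
    (fun y => y) Finset.univ
  have hsum : ∀ f : ℝ → ℝ, ∑ y : s, f y = ∑ y ∈ s, f y := fun f => Finset.sum_coe_sort s f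
  have hI : ∀ ω, ∑ y : s, (y : ℝ) * L (φ ⁻¹' {(y : ℝ)} ∩ A) ω = simpleStochInt L φ A ω :=
    fun ω => by
      rw [simpleStochInt_eq_sum_ne_zero]
      exact hsum fun y => y * L (φ ⁻¹' {y} ∩ A) ω
  have hk : ∀ k : ℕ, k ≠ 0 →
      ∑ y : s, (y : ℝ) ^ k * (volume (φ ⁻¹' {(y : ℝ)} ∩ A)).toReal = ∫ z in A, φ z ^ k :=
    fun k hk => by
      rw [setIntegral_simpleFunc_pow hφ hk]
      exact hsum fun y => y ^ k * (volume (φ ⁻¹' {y} ∩ A)).toReal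
  simp_rw [hI, hk 2 two_ne_zero, hk 4 four_ne_zero] at h
  exact h

/-- A level set of `g ∘ χ` is a finite disjoint union of fibres of `χ`, so additivity lets the
integral be computed on the finer partition. Linearity follows by passing to a common refinement. -/
theorem simpleStochInt_map (hL : IsLevyBasis P L) {β : Type*} (χ : SimpleFunc (ℝ × ℝ) β)
    (g : β → ℝ) (hb : ∀ b, g b ≠ 0 → Bornology.IsBounded (χ ⁻¹' {b}))
    {A : Set (ℝ × ℝ)} (hA : MeasurableSet A) :
    simpleStochInt L (χ.map g) A =ᵐ[P] fun ω => ∑ b ∈ χ.range, g b * L (χ ⁻¹' {b} ∩ A) ω := by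
  classical
  have hfib : ∀ y : ℝ, (χ.map g) ⁻¹' {y} ∩ A =
      ⋃ b ∈ χ.range.filter (g · = y), χ ⁻¹' {b} ∩ A := by
    intro y
    ext z
    simp only [SimpleFunc.coe_map, Set.mem_inter_iff, Set.mem_preimage, Function.comp_apply,
      Set.mem_singleton_iff, Finset.mem_filter, SimpleFunc.mem_range, Set.mem_range,
      Set.mem_iUnion, exists_prop]
    constructor
    · rintro ⟨h1, h2⟩
      exact ⟨χ z, ⟨⟨z, rfl⟩, h1⟩, rfl, h2⟩
    · rintro ⟨b, ⟨-, h1⟩, rfl, h2⟩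
      exact ⟨h1, h2⟩
  have hy : ∀ y ∈ (χ.map g).range, ∀ᵐ ω ∂P, y * L ((χ.map g) ⁻¹' {y} ∩ A) ω =
      ∑ b ∈ χ.range with g b = y, g b * L (χ ⁻¹' {b} ∩ A) ω := by
    intro y _
    rcases eq_or_ne y 0 with rfl | hy0
    · refine .of_forall fun ω => ?_
      rw [zero_mul, Finset.sum_eq_zero]
      intro b hb
      rw [(Finset.mem_filter.1 hb).2, zero_mul]
    · have h := hL.ae_biUnion (χ.range.filter (g · = y)) (A := fun b => χ ⁻¹' {b} ∩ A)
        (fun b _ => (χ.measurableSet_preimage _).inter hA)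
        (fun b hb' => (hb b (by rw [(Finset.mem_filter.1 hb').2]; exact hy0)).subset
          Set.inter_subset_left)
        (fun b _ c _ hbc => Set.disjoint_left.2 fun z hz1 hz2 =>
          hbc ((show χ z = b from hz1.1).symm.trans hz2.1))
      rw [← hfib] at h
      filter_upwards [h] with ω hω
      rw [hω, Finset.mul_sum]
      refine Finset.sum_congr rfl fun b hb => ?_
      rw [(Finset.mem_filter.1 hb).2]
  have hall := (Finset.eventually_all _).2 hy
  filter_upwards [hall] with ω hω
  rw [simpleStochInt, Finset.sum_congr rfl hω]
  refine Finset.sum_fiberwise_of_maps_to (fun b hb => ?_) _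
  rw [SimpleFunc.range_map]
  exact Finset.mem_image_of_mem g hb

/-- The linear combination of two simple functions. -/
def _root_.MeasureTheory.SimpleFunc.linComb (a b : ℝ) (φ ψ : SimpleFunc (ℝ × ℝ) ℝ) :
    SimpleFunc (ℝ × ℝ) ℝ := (φ.pair ψ).map fun p => a * p.1 + b * p.2

@[simp] theorem _root_.MeasureTheory.SimpleFunc.linComb_apply (a b : ℝ)
    (φ ψ : SimpleFunc (ℝ × ℝ) ℝ) (z : ℝ × ℝ) :
    SimpleFunc.linComb a b φ ψ z = a * φ z + b * ψ z := rfl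

theorem _root_.MeasureTheory.SimpleFunc.isBounded_support_linComb (a b : ℝ)
    {φ ψ : SimpleFunc (ℝ × ℝ) ℝ} (hφ : Bornology.IsBounded (Function.support φ))
    (hψ : Bornology.IsBounded (Function.support ψ)) :
    Bornology.IsBounded (Function.support (SimpleFunc.linComb a b φ ψ)) := by
  refine (hφ.union hψ).subset fun z hz => ?_
  by_contra h
  simp only [Set.mem_union, Function.mem_support, not_or, not_not] at h
  exact hz (by simp [h.1, h.2])

theorem simpleStochInt_linComb (hL : IsLevyBasis P L) (a b : ℝ) {φ ψ : SimpleFunc (ℝ × ℝ) ℝ}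
    (hφ : Bornology.IsBounded (Function.support φ))
    (hψ : Bornology.IsBounded (Function.support ψ)) {A : Set (ℝ × ℝ)} (hA : MeasurableSet A) :
    simpleStochInt L (SimpleFunc.linComb a b φ ψ) A =ᵐ[P]
      fun ω => a * simpleStochInt L φ A ω + b * simpleStochInt L ψ A ω := by
  have hbdd : ∀ p : ℝ × ℝ, p ≠ 0 → Bornology.IsBounded (φ.pair ψ ⁻¹' {p}) := by
    intro p hp
    refine (hφ.union hψ).subset fun z hz => ?_
    by_contra h
    simp only [Set.mem_union, Function.mem_support, not_or, not_not] at h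
    apply hp
    rw [← show φ.pair ψ z = p from hz, SimpleFunc.pair_apply, h.1, h.2]
    rfl
  -- All three integrals are written over the fibres of the pair, where the identity holds term by
  -- term.
  have h1 := hL.simpleStochInt_map (φ.pair ψ) (fun p => a * p.1 + b * p.2)
    (fun p hp => hbdd p (by rintro rfl; simp at hp)) hA
  have h2 := hL.simpleStochInt_map (φ.pair ψ) Prod.fst
    (fun p hp => hbdd p (by rintro rfl; simp at hp)) hA
  have h3 := hL.simpleStochInt_map (φ.pair ψ) Prod.snd
    (fun p hp => hbdd p (by rintro rfl; simp at hp)) hA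
  rw [SimpleFunc.map_fst_pair] at h2
  rw [SimpleFunc.map_snd_pair] at h3
  filter_upwards [h1, h2, h3] with ω h1 h2 h3
  rw [SimpleFunc.linComb, h1, h2, h3, Finset.mul_sum, Finset.mul_sum, ← Finset.sum_add_distrib]
  refine Finset.sum_congr rfl fun p _ => ?_
  ring

theorem simpleStochInt_union (hL : IsLevyBasis P L) {φ : SimpleFunc (ℝ × ℝ) ℝ}
    (hφ : Bornology.IsBounded (Function.support φ)) {A B : Set (ℝ × ℝ)} (hA : MeasurableSet A)
    (hB : MeasurableSet B) (hAB : Disjoint A B) :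
    simpleStochInt L φ (A ∪ B) =ᵐ[P] simpleStochInt L φ A + simpleStochInt L φ B := by
  have hy : ∀ y ∈ φ.range.filter (· ≠ 0), ∀ᵐ ω ∂P, y * L (φ ⁻¹' {y} ∩ (A ∪ B)) ω =
      y * L (φ ⁻¹' {y} ∩ A) ω + y * L (φ ⁻¹' {y} ∩ B) ω := by
    intro y hy
    have hy0 := (Finset.mem_filter.1 hy).2
    have h := hL.ae_union ((φ.measurableSet_preimage {y}).inter hA)
      ((φ.measurableSet_preimage {y}).inter hB) (isBounded_preimage_singleton hφ hy0 A)
      (isBounded_preimage_singleton hφ hy0 B)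
      (hAB.mono Set.inter_subset_right Set.inter_subset_right)
    rw [← Set.inter_union_distrib_left] at h
    filter_upwards [h] with ω hω
    rw [hω, Pi.add_apply, mul_add]
  filter_upwards [(Finset.eventually_all _).2 hy] with ω hω
  simp only [Pi.add_apply, simpleStochInt_eq_sum_ne_zero]
  rw [Finset.sum_congr rfl hω, Finset.sum_add_distrib]

end IsLevyBasis

/-! ### Convergence in probability and in mean -/

theorem MeasureTheory.TendstoInMeasure.linComb {Ω : Type*} [MeasurableSpace Ω] {P : Measure Ω}
    {ι : Type*} {l : Filter ι} {f f' : ι → Ω → ℝ} {g g' : Ω → ℝ}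
    (h : TendstoInMeasure P f l g) (h' : TendstoInMeasure P f' l g') (a b : ℝ) :
    TendstoInMeasure P (fun i ω => a * f i ω + b * f' i ω) l (fun ω => a * g ω + b * g' ω) := by
  rw [tendstoInMeasure_iff_norm] at *
  intro ε hε
  -- The `+ 1` keeps the denominator positive when `a = b = 0`.
  set δ := ε / (|a| + |b| + 1) with hδ
  have hpos : 0 < |a| + |b| + 1 := by positivity
  have hδ0 : 0 < δ := div_pos hε hpos
  have ht := (h δ hδ0).add (h' δ hδ0)
  rw [add_zero] at ht
  refine tendsto_of_tendsto_of_tendsto_of_le_of_le tendsto_const_nhds ht (fun _ => zero_le)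
    fun i => (measure_mono fun ω hω => ?_).trans (measure_union_le _ _)
  by_contra hcon
  simp only [Set.mem_union, Set.mem_ofPred_eq, not_or, not_le, Real.norm_eq_abs] at hcon hω
  have h1 : |a * f i ω + b * f' i ω - (a * g ω + b * g' ω)| ≤
      |a| * |f i ω - g ω| + |b| * |f' i ω - g' ω| := by
    rw [← abs_mul, ← abs_mul]
    refine le_trans (le_of_eq ?_) (abs_add_le _ _)
    congr 1; ring
  have h2 : |a| * |f i ω - g ω| ≤ |a| * δ := mul_le_mul_of_nonneg_left hcon.1.le (abs_nonneg a)
  have h3 : |b| * |f' i ω - g' ω| ≤ |b| * δ := mul_le_mul_of_nonneg_left hcon.2.le (abs_nonneg b)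
  have h4 : (|a| + |b| + 1) * δ = ε := mul_div_cancel₀ _ hpos.ne'
  linarith

theorem eLpNorm_eq_ofReal_integral_pow {Ω : Type*} [MeasurableSpace Ω] {P : Measure Ω}
    {X : Ω → ℝ} {k : ℕ} (hk0 : k ≠ 0) (hk : Even k) (hX : MemLp X k P) :
    eLpNorm X k P = ENNReal.ofReal ((∫ ω, X ω ^ k ∂P) ^ ((k : ℝ)⁻¹)) := by
  rw [hX.eLpNorm_eq_integral_rpow_norm (by exact_mod_cast hk0) (ENNReal.natCast_ne_top k)]
  simp only [ENNReal.toReal_natCast, Real.rpow_natCast, Real.norm_eq_abs, hk.pow_abs]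

theorem tendsto_eLpNorm_of_tendsto_integral_pow {Ω ι : Type*} [MeasurableSpace Ω] {P : Measure Ω}
    {l : Filter ι} {X : ι → Ω → ℝ} {k : ℕ} (hk0 : k ≠ 0) (hk : Even k) (hX : ∀ i, MemLp (X i) k P)
    (h : Tendsto (fun i => ∫ ω, X i ω ^ k ∂P) l (𝓝 0)) :
    Tendsto (fun i => eLpNorm (X i) k P) l (𝓝 0) := by
  simp_rw [fun i => eLpNorm_eq_ofReal_integral_pow hk0 hk (hX i)]
  have h1 := (Real.continuousAt_rpow_const 0 ((k : ℝ)⁻¹) (.inr (by positivity))).tendsto.comp h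
  rw [Real.zero_rpow (by positivity)] at h1
  simpa [Function.comp_def] using (ENNReal.continuous_ofReal.tendsto 0).comp h1

/-! ### Uniqueness of the integral by a gliding hump -/

/-- The measure with density `φ ^ 2` with respect to Lebesgue measure. -/
noncomputable def sqDensity (φ : SimpleFunc (ℝ × ℝ) ℝ) : Measure (ℝ × ℝ) :=
  volume.withDensity fun z => ENNReal.ofReal (φ z ^ 2)

theorem ofReal_setIntegral_sq {φ : SimpleFunc (ℝ × ℝ) ℝ}
    (hφ : Bornology.IsBounded (Function.support φ)) {A : Set (ℝ × ℝ)} (hA : MeasurableSet A) :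
    ENNReal.ofReal (∫ z in A, φ z ^ 2) = sqDensity φ A := by
  rw [sqDensity, withDensity_apply _ hA, ofReal_integral_eq_lintegral_ofReal]
  · exact (SimpleFunc.integrable_pow_of_isBounded_support hφ two_ne_zero).restrict
  · exact .of_forall fun z => sq_nonneg _

theorem isFiniteMeasure_sqDensity {φ : SimpleFunc (ℝ × ℝ) ℝ}
    (hφ : Bornology.IsBounded (Function.support φ)) : IsFiniteMeasure (sqDensity φ) :=
  ⟨by rw [← ofReal_setIntegral_sq hφ .univ]; exact ENNReal.ofReal_lt_top⟩

namespace IsLevyBasis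

variable {Ω : Type*} [MeasurableSpace Ω] {P : Measure Ω} [IsProbabilityMeasure P]
  {L : Set (ℝ × ℝ) → Ω → ℝ}

/-- The second moment is `κ₂` times the `φ²`-mass of the set, and convergence in `L²` implies
convergence in probability. The set may vary with `n`. -/
theorem tendstoInMeasure_simpleStochInt_zero (hL : IsLevyBasis P L) {κ₂ κ₄ : ℝ}
    (hmom : ∀ A, MeasurableSet A → Bornology.IsBounded A →
      HasSemigroupMoments (P.map (L A)) (volume A).toReal κ₂ κ₄)
    {φ : ℕ → SimpleFunc (ℝ × ℝ) ℝ} (hφ : ∀ n, Bornology.IsBounded (Function.support (φ n)))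
    {A : ℕ → Set (ℝ × ℝ)} (hA : ∀ n, MeasurableSet (A n))
    (h : Tendsto (fun n => sqDensity (φ n) (A n)) atTop (𝓝 0)) :
    TendstoInMeasure P (fun n => simpleStochInt L (φ n) (A n)) atTop 0 := by
  have hLp : ∀ n, MemLp (simpleStochInt L (φ n) (A n)) (2 : ℕ) P := fun n =>
    (hL.moments_simpleStochInt hmom (hφ n) (hA n)).1.mono_exponent (by norm_num)
  have hI : Tendsto (fun n => ∫ ω, simpleStochInt L (φ n) (A n) ω ^ 2 ∂P) atTop (𝓝 0) := by
    simp_rw [fun n => (hL.moments_simpleStochInt hmom (hφ n) (hA n)).2.2.1]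
    have h1 : ∀ n, (sqDensity (φ n) (A n)).toReal = ∫ z in A n, φ n z ^ 2 := fun n => by
      rw [← ofReal_setIntegral_sq (hφ n) (hA n),
        ENNReal.toReal_ofReal (integral_nonneg fun z => sq_nonneg _)]
    simp_rw [← h1]
    simpa using ((ENNReal.tendsto_toReal ENNReal.zero_ne_top).comp h).const_mul κ₂
  refine tendstoInMeasure_of_tendsto_eLpNorm (p := (2 : ℕ)) (by norm_num) (fun n => (hLp n).1)
    aestronglyMeasurable_zero ?_
  simpa using tendsto_eLpNorm_of_tendsto_integral_pow two_ne_zero even_two hLp hI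

/-- Well-definedness of the stochastic integral: if simple functions tend to zero almost everywhere
and their integrals over every Borel set converge in probability, then the integrals over the whole
space tend to zero. -/
theorem ae_eq_zero_of_tendstoInMeasure (hL : IsLevyBasis P L) {κ₂ κ₄ : ℝ}
    (hmom : ∀ A, MeasurableSet A → Bornology.IsBounded A →
      HasSemigroupMoments (P.map (L A)) (volume A).toReal κ₂ κ₄)
    {φ : ℕ → SimpleFunc (ℝ × ℝ) ℝ} (hφ : ∀ n, Bornology.IsBounded (Function.support (φ n)))
    (h0 : ∀ᵐ z, Tendsto (fun n => φ n z) atTop (𝓝 0))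
    (hconv : ∀ A, MeasurableSet A → ∃ Z : Ω → ℝ,
      TendstoInMeasure P (fun n => simpleStochInt L (φ n) A) atTop Z) {X : Ω → ℝ}
    (hX : TendstoInMeasure P (fun n => simpleStochInt L (φ n) Set.univ) atTop X) :
    X =ᵐ[P] 0 := by
  -- Lebesgue measure is infinite, so smallness is measured against a positive integrable weight:
  -- `φ² ≤ 2⁻ᵏ w` off a set makes the mass there at most `2⁻ᵏ`.
  obtain ⟨w, hw0, hwm, hw1⟩ := exists_pos_lintegral_lt_of_sigmaFinite
    (volume : Measure (ℝ × ℝ)) one_ne_zero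
  have hfin : ∀ n, IsFiniteMeasure (sqDensity (φ n)) := fun n => isFiniteMeasure_sqDensity (hφ n)
  -- the set on which `φ n` is not yet small
  set C : ℕ × ℕ → Set (ℝ × ℝ) := fun x =>
    {z | (2⁻¹ : ENNReal) ^ x.1 * w z < ENNReal.ofReal (φ x.2 z ^ 2)} with hC
  have hCm : ∀ x, MeasurableSet (C x) := fun x =>
    measurableSet_lt (by fun_prop) (((φ x.2).measurable.pow_const 2).ennreal_ofReal)
  have hCc : ∀ x, sqDensity (φ x.2) (C x)ᶜ ≤ (2⁻¹ : ENNReal) ^ x.1 := by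
    intro x
    rw [sqDensity, withDensity_apply _ (hCm x).compl]
    calc ∫⁻ z in (C x)ᶜ, ENNReal.ofReal (φ x.2 z ^ 2)
        ≤ ∫⁻ z in (C x)ᶜ, (2⁻¹ : ENNReal) ^ x.1 * w z :=
          setLIntegral_mono (by fun_prop) fun z hz => not_lt.1 hz
      _ ≤ ∫⁻ z, (2⁻¹ : ENNReal) ^ x.1 * w z := setLIntegral_le_lintegral _ _
      _ = (2⁻¹ : ENNReal) ^ x.1 * ∫⁻ z, w z := lintegral_const_mul _ (by fun_prop)
      _ ≤ (2⁻¹ : ENNReal) ^ x.1 * 1 := by gcongr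
      _ = _ := mul_one _
  -- For fixed `j` the `φ j ^ 2`-mass is a finite measure, and almost every point eventually leaves
  -- `C (k, n)` because `φ n` tends to zero there.
  have hCt : ∀ j k, Tendsto (fun n => sqDensity (φ j) (C (k, n))) atTop (𝓝 0) := by
    intro j k
    rw [← measure_empty (μ := sqDensity (φ j))]
    refine tendsto_measure_of_ae_tendsto_indicator_of_isFiniteMeasure _ .empty
      (fun n => hCm (k, n)) ?_
    refine (withDensity_absolutelyContinuous _ _).ae_le ?_
    filter_upwards [h0] with z hz
    have h1 : Tendsto (fun n => ENNReal.ofReal (φ n z ^ 2)) atTop (𝓝 0) := by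
      simpa [Function.comp_def] using (ENNReal.continuous_ofReal.tendsto _).comp (hz.pow 2)
    have h2 : (0 : ENNReal) < (2⁻¹ : ENNReal) ^ k * w z :=
      ENNReal.mul_pos (pow_ne_zero _ (by simp)) (by simpa using (hw0 z).ne')
    filter_upwards [h1.eventually_lt_const h2] with n hn
    simp only [hC, Set.mem_ofPred_eq, Set.mem_empty_iff_false, iff_false, not_lt]
    exact hn.le
  -- Each new pair is chosen so late that every earlier function has tiny mass on the new set.
  obtain ⟨s, -, hs⟩ := exists_seq_of_forall_finset_exists (α := ℕ × ℕ) (fun _ => True)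
    (fun x y => x.1 < y.1 ∧ x.2 < y.2 ∧ sqDensity (φ x.2) (C y) ≤ (2⁻¹ : ENNReal) ^ y.1) (by
      intro s _
      set k := s.sup Prod.fst + 1 with hk
      have h1 : ∀ x ∈ s, ∀ᶠ n in atTop,
          x.2 < n ∧ sqDensity (φ x.2) (C (k, n)) ≤ (2⁻¹ : ENNReal) ^ k := fun x _ =>
        (eventually_gt_atTop x.2).and ((hCt x.2 k).eventually_le_const
          (pos_iff_ne_zero.2 (pow_ne_zero _ (by simp))))
      obtain ⟨n, hn⟩ := ((Finset.eventually_all s).2 h1).exists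
      exact ⟨(k, n), trivial, fun x hx =>
        ⟨Nat.lt_succ_of_le (Finset.le_sup (f := Prod.fst) hx), hn x hx⟩⟩)
  have hk : StrictMono fun j => (s j).1 := fun i j hij => (hs i j hij).1
  have hn : StrictMono fun j => (s j).2 := fun i j hij => (hs i j hij).2.1
  have hpow : ∀ j, (2⁻¹ : ENNReal) ^ (s j).1 ≤ (2⁻¹ : ENNReal) ^ j := fun j =>
    pow_le_pow_right_of_le_one' (by simp) hk.le_apply
  set D : ℕ → Set (ℝ × ℝ) := fun j => ⋃ i, C (s (j + 1 + i)) with hD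
  have hDm : ∀ j, MeasurableSet (D j) := fun j => .iUnion fun i => hCm _
  have hCD : ∀ {i j}, i < j → C (s j) ⊆ D i := by
    intro i j hij
    obtain ⟨l, rfl⟩ := Nat.exists_eq_add_of_le hij
    exact Set.subset_iUnion (fun l => C (s (i + 1 + l))) l
  have hDle : ∀ j, sqDensity (φ (s j).2) (D j) ≤ (2⁻¹ : ENNReal) ^ j := by
    intro j
    calc sqDensity (φ (s j).2) (D j) ≤ ∑' i, sqDensity (φ (s j).2) (C (s (j + 1 + i))) :=
          measure_iUnion_le _
      _ ≤ ∑' i, (2⁻¹ : ENNReal) ^ (j + 1 + i) := ENNReal.tsum_le_tsum fun i =>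
          (hs j (j + 1 + i) (by omega)).2.2.trans (hpow _)
      _ = (2⁻¹ : ENNReal) ^ j := by
          simp_rw [pow_add _ (j + 1)]
          rw [ENNReal.tsum_mul_left, ENNReal.tsum_geometric, ENNReal.one_sub_inv_two, inv_inv,
            pow_succ, mul_assoc, ENNReal.inv_mul_cancel (by simp) (by simp), mul_one]
  -- The even humps, each stripped of all later humps. An even-indexed function has almost all its
  -- mass in `A`. An odd hump meets `A` only inside later humps, where its function has little mass,
  -- since the earlier even pieces have had it removed.
  set A : Set (ℝ × ℝ) := ⋃ j, C (s (2 * j)) \ D (2 * j) with hA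
  have hAm : MeasurableSet A := .iUnion fun j => (hCm _).diff (hDm _)
  have hsmall : ∀ j (B : Set (ℝ × ℝ)), B ⊆ (C (s j))ᶜ ∪ D j →
      sqDensity (φ (s j).2) B ≤ 2 * (2⁻¹ : ENNReal) ^ j := by
    intro j B hB
    refine (measure_mono hB).trans ((measure_union_le _ _).trans ?_)
    rw [two_mul]
    exact add_le_add ((hCc _).trans (hpow j)) (hDle j)
  have heven : ∀ j, sqDensity (φ (s (2 * j)).2) Aᶜ ≤ 2 * (2⁻¹ : ENNReal) ^ (2 * j) := by
    intro j
    refine hsmall _ _ fun z hz => ?_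
    by_contra hcon
    simp only [Set.mem_union, Set.mem_compl_iff, not_or, not_not] at hcon
    exact hz (Set.mem_iUnion.2 ⟨j, hcon⟩)
  have hodd : ∀ j, sqDensity (φ (s (2 * j + 1)).2) A ≤ 2 * (2⁻¹ : ENNReal) ^ (2 * j + 1) := by
    intro j
    refine hsmall _ _ fun z hz => ?_
    obtain ⟨i, hi1, hi2⟩ := Set.mem_iUnion.1 hz
    by_cases hzC : z ∈ C (s (2 * j + 1))
    · right
      rcases lt_or_ge (2 * i) (2 * j + 1) with h | h
      · exact absurd (hCD h hzC) hi2
      · exact hCD (by omega : 2 * j + 1 < 2 * i) hi1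
    · exact .inl hzC
  have hzero : Tendsto (fun j : ℕ => 2 * (2⁻¹ : ENNReal) ^ j) atTop (𝓝 0) := by
    have h := ENNReal.Tendsto.const_mul (a := 2)
      (ENNReal.tendsto_pow_atTop_nhds_zero_of_lt_one (r := 2⁻¹) (by simp)) (.inr (by simp))
    rwa [mul_zero] at h
  have h2j : Tendsto (fun j : ℕ => 2 * j) atTop atTop :=
    tendsto_id.const_mul_atTop' (by norm_num)
  have h2j1 : Tendsto (fun j : ℕ => 2 * j + 1) atTop atTop := (tendsto_add_atTop_nat 1).comp h2j
  have t1 := hL.tendstoInMeasure_simpleStochInt_zero hmom (fun j => hφ (s (2 * j)).2)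
    (fun _ => hAm.compl) (tendsto_of_tendsto_of_tendsto_of_le_of_le tendsto_const_nhds
      (hzero.comp h2j) (fun _ => zero_le) heven)
  have t2 := hL.tendstoInMeasure_simpleStochInt_zero hmom (fun j => hφ (s (2 * j + 1)).2)
    (fun _ => hAm) (tendsto_of_tendsto_of_tendsto_of_le_of_le tendsto_const_nhds
      (hzero.comp h2j1) (fun _ => zero_le) hodd)
  obtain ⟨Z, hZ⟩ := hconv A hAm
  -- Odd indices show that the limit over `A` is zero; even indices show that the complement of `A`
  -- contributes nothing, so the total limit equals the limit over `A`.
  have hZ0 : Z =ᵐ[P] 0 :=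
    tendstoInMeasure_ae_unique (hZ.comp (hn.tendsto_atTop.comp h2j1)) t2
  have hXZ : X =ᵐ[P] fun ω => 1 * Z ω + 1 * (0 : Ω → ℝ) ω := by
    refine tendstoInMeasure_ae_unique (hX.comp (hn.tendsto_atTop.comp h2j)) ?_
    refine TendstoInMeasure.congr_left (fun j => ?_)
      ((hZ.comp (hn.tendsto_atTop.comp h2j)).linComb t1 1 1)
    have h := hL.simpleStochInt_union (hφ (s (2 * j)).2) hAm hAm.compl disjoint_compl_right
    rw [Set.union_compl_self] at h
    filter_upwards [h] with ω hω
    simp [hω]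
  filter_upwards [hXZ, hZ0] with ω h1 h2
  simp [h1, h2]

end IsLevyBasis

/-! ### Moments of the integral of a function in `L² ∩ L⁴` -/

theorem integrable_pow_of_memLp {α : Type*} [MeasurableSpace α] {μ : Measure α} {g : α → ℝ} {k : ℕ}
    (hk : k ≠ 0) (hg : MemLp g k μ) : Integrable (fun z => g z ^ k) μ := by
  refine (integrable_norm_iff (hg.1.pow k)).1 ?_
  simpa [norm_pow] using hg.integrable_norm_pow hk

/-- A measurable function is the almost everywhere limit of simple functions with bounded support
that are dominated by a multiple of it. -/
theorem exists_simpleFunc_tendsto_ae {g : ℝ × ℝ → ℝ} (hg : AEStronglyMeasurable g volume) :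
    ∃ ψ : ℕ → SimpleFunc (ℝ × ℝ) ℝ, (∀ n, Bornology.IsBounded (Function.support (ψ n))) ∧
      (∀ᵐ z, Tendsto (fun n => ψ n z) atTop (𝓝 (g z))) ∧ ∀ n, ∀ᵐ z, |ψ n z| ≤ 2 * |g z| := by
  have hm : Measurable (hg.mk g) := hg.stronglyMeasurable_mk.measurable
  -- The base point `0` yields the bound by twice the function; cutting off to balls makes the
  -- supports bounded.
  set χ := SimpleFunc.approxOn (hg.mk g) hm Set.univ 0 (Set.mem_univ _) with hχ
  have happ : ∀ n z, (χ n).restrict (Metric.ball 0 n) z =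
      (Metric.ball (0 : ℝ × ℝ) n).indicator (χ n) z := fun n z => by
    rw [SimpleFunc.restrict_apply _ measurableSet_ball]
  refine ⟨fun n => (χ n).restrict (Metric.ball 0 n), fun n => ?_, ?_, fun n => ?_⟩
  · refine (Metric.isBounded_ball (x := (0 : ℝ × ℝ)) (r := n)).subset fun z hz => ?_
    rw [Function.mem_support, happ] at hz
    exact Set.mem_of_indicator_ne_zero hz
  · filter_upwards [hg.ae_eq_mk] with z hz
    rw [hz]
    have h1 : Tendsto (fun n => χ n z) atTop (𝓝 (hg.mk g z)) :=
      SimpleFunc.tendsto_approxOn hm (Set.mem_univ _) (by simp)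
    refine h1.congr' ?_
    obtain ⟨N, hN⟩ := exists_nat_gt ‖z‖
    filter_upwards [eventually_ge_atTop N] with n hn
    rw [happ, Set.indicator_of_mem]
    rw [mem_ball_zero_iff]
    exact hN.trans_le (by exact_mod_cast hn)
  · filter_upwards [hg.ae_eq_mk] with z hz
    rw [hz, happ, ← Real.norm_eq_abs, ← Real.norm_eq_abs, two_mul]
    exact (norm_indicator_le_norm_self _ _).trans
      (SimpleFunc.norm_approxOn_zero_le hm (Set.mem_univ _) z n)

theorem tendsto_integral_pow_sub {α : Type*} [MeasurableSpace α] {μ : Measure α} {g : α → ℝ}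
    {ψ : ℕ → α → ℝ} (hm : ∀ n, AEStronglyMeasurable (ψ n) μ) {k : ℕ} (hk : k ≠ 0) (hg : MemLp g k μ)
    (ht : ∀ᵐ z ∂μ, Tendsto (fun n => ψ n z) atTop (𝓝 (g z)))
    (hb : ∀ n, ∀ᵐ z ∂μ, |ψ n z| ≤ 2 * |g z|) :
    Tendsto (fun n => ∫ z, (ψ n z - g z) ^ k ∂μ) atTop (𝓝 0) := by
  have h : Tendsto (fun n => ∫ z, (ψ n z - g z) ^ k ∂μ) atTop (𝓝 (∫ _, 0 ∂μ)) := by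
    refine tendsto_integral_of_dominated_convergence (fun z => (3 * |g z|) ^ k)
      (fun n => ((hm n).sub hg.1).pow k) ?_ (fun n => ?_) ?_
    · exact integrable_pow_of_memLp hk (hg.abs.const_mul 3)
    · filter_upwards [hb n] with z hz
      rw [norm_pow, Real.norm_eq_abs]
      gcongr
      exact (abs_sub _ _).trans (by linarith)
    · filter_upwards [ht] with z hz
      simpa [hk] using (hz.sub_const (g z)).pow k
  simpa using h

theorem tendsto_integral_pow {α : Type*} [MeasurableSpace α] {μ : Measure α} {g : α → ℝ}
    {ψ : ℕ → α → ℝ} (hm : ∀ n, AEStronglyMeasurable (ψ n) μ) {k : ℕ} (hk : k ≠ 0) (hg : MemLp g k μ)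
    (ht : ∀ᵐ z ∂μ, Tendsto (fun n => ψ n z) atTop (𝓝 (g z)))
    (hb : ∀ n, ∀ᵐ z ∂μ, |ψ n z| ≤ 2 * |g z|) :
    Tendsto (fun n => ∫ z, ψ n z ^ k ∂μ) atTop (𝓝 (∫ z, g z ^ k ∂μ)) := by
  refine tendsto_integral_of_dominated_convergence (fun z => (2 * |g z|) ^ k)
    (fun n => (hm n).pow k) ?_ (fun n => ?_) ?_
  · exact integrable_pow_of_memLp hk (hg.abs.const_mul 2)
  · filter_upwards [hb n] with z hz
    rw [norm_pow, Real.norm_eq_abs]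
    gcongr
  · filter_upwards [ht] with z hz
    exact hz.pow k

theorem tendsto_integral_pow_of_tendsto_eLpNorm {Ω : Type*} [MeasurableSpace Ω] {P : Measure Ω}
    {X : ℕ → Ω → ℝ} {Z : Ω → ℝ} {k : ℕ} (hk0 : k ≠ 0) (hk : Even k) (hX : ∀ n, MemLp (X n) k P)
    (hZ : MemLp Z k P) (h : Tendsto (fun n => eLpNorm (X n - Z) k P) atTop (𝓝 0)) :
    Tendsto (fun n => ∫ ω, X n ω ^ k ∂P) atTop (𝓝 (∫ ω, Z ω ^ k ∂P)) := by
  have : Fact (1 ≤ (k : ENNReal)) := ⟨by exact_mod_cast Nat.one_le_iff_ne_zero.2 hk0⟩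
  have h1 := ((Lp.tendsto_Lp_iff_tendsto_eLpNorm'' X hX Z hZ).2 h).norm.pow k
  have h2 : ∀ {Y : Ω → ℝ} (hY : MemLp Y k P), ‖hY.toLp Y‖ ^ k = ∫ ω, Y ω ^ k ∂P := by
    intro Y hY
    have h0 : 0 ≤ ∫ ω, Y ω ^ k ∂P := integral_nonneg fun ω => hk.pow_nonneg _
    rw [Lp.norm_toLp, eLpNorm_eq_ofReal_integral_pow hk0 hk hY, ENNReal.toReal_ofReal (by positivity),
      Real.rpow_inv_natCast_pow h0 hk0]
  simpa only [h2] using h1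

namespace IsLevyBasis

variable {Ω : Type*} [MeasurableSpace Ω] {P : Measure Ω} [IsProbabilityMeasure P]
  {L : Set (ℝ × ℝ) → Ω → ℝ}

/-- The integrals of simple functions over a fixed Borel set converge in `L⁴(P)` if the functions
converge in `L²` and in `L⁴`. -/
theorem exists_tendsto_eLpNorm_simpleStochInt (hL : IsLevyBasis P L) {κ₂ κ₄ : ℝ}
    (hmom : ∀ A, MeasurableSet A → Bornology.IsBounded A →
      HasSemigroupMoments (P.map (L A)) (volume A).toReal κ₂ κ₄)
    {g : ℝ × ℝ → ℝ} (hg2 : MemLp g 2) (hg4 : MemLp g 4)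
    {ψ : ℕ → SimpleFunc (ℝ × ℝ) ℝ} (hψ : ∀ n, Bornology.IsBounded (Function.support (ψ n)))
    (h2 : Tendsto (fun n => ∫ z, (ψ n z - g z) ^ 2) atTop (𝓝 0))
    (h4 : Tendsto (fun n => ∫ z, (ψ n z - g z) ^ 4) atTop (𝓝 0))
    {A : Set (ℝ × ℝ)} (hA : MeasurableSet A) :
    ∃ Z : Ω → ℝ, MemLp Z 4 P ∧
      Tendsto (fun n => eLpNorm (simpleStochInt L (ψ n) A - Z) 4 P) atTop (𝓝 0) := by
  have : Fact ((1 : ENNReal) ≤ 4) := ⟨by norm_num⟩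
  have hLp : ∀ n, MemLp (simpleStochInt L (ψ n) A) 4 P := fun n =>
    (hL.moments_simpleStochInt hmom (hψ n) hA).1
  have hi : ∀ n {k : ℕ}, k ≠ 0 → MemLp g k → Integrable (fun z => (ψ n z - g z) ^ k) :=
    fun n k hk hg => by
      refine integrable_pow_of_memLp hk (MemLp.sub ?_ hg)
      exact (SimpleFunc.memLp_iff_integrable (by exact_mod_cast hk) (ENNReal.natCast_ne_top k)).2
        (SimpleFunc.integrable_of_isBounded_support (hψ n))
  -- Both terms are compared with `g`, using `(x + y)ᵏ ≤ 2ᵏ⁻¹ (xᵏ + yᵏ)` for `x, y ≥ 0`.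
  have hsub : ∀ (n m) {k : ℕ}, k ≠ 0 → Even k → MemLp g k →
      ∫ z in A, SimpleFunc.linComb 1 (-1) (ψ n) (ψ m) z ^ k ≤
        2 ^ (k - 1) * ((∫ z, (ψ n z - g z) ^ k) + ∫ z, (ψ m z - g z) ^ k) := by
    intro n m k hk0 hk hg
    rw [← integral_add (hi n hk0 hg) (hi m hk0 hg), ← integral_const_mul]
    refine (setIntegral_le_integral (SimpleFunc.integrable_pow_of_isBounded_support
      (SimpleFunc.isBounded_support_linComb _ _ (hψ n) (hψ m)) hk0)
      (.of_forall fun z => hk.pow_nonneg _)).trans ?_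
    refine integral_mono (SimpleFunc.integrable_pow_of_isBounded_support
      (SimpleFunc.isBounded_support_linComb _ _ (hψ n) (hψ m)) hk0)
      (((hi n hk0 hg).add (hi m hk0 hg)).const_mul _) fun z => ?_
    have h := add_pow_le (abs_nonneg (ψ n z - g z)) (abs_nonneg (ψ m z - g z)) k
    rw [hk.pow_abs, hk.pow_abs] at h
    refine le_trans ?_ h
    rw [← hk.pow_abs]
    refine pow_le_pow_left₀ (abs_nonneg _) ?_ k
    rw [SimpleFunc.linComb_apply]
    refine le_trans (le_of_eq ?_) (abs_sub (ψ n z - g z) (ψ m z - g z))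
    congr 1; ring
  set F : ℕ → Lp ℝ 4 P := fun n => (hLp n).toLp _ with hF
  have hcauchy : CauchySeq F := by
    rw [Lp.cauchySeq_Lp_iff_cauchySeq_eLpNorm]
    have hD : ∀ p : ℕ × ℕ, simpleStochInt L (SimpleFunc.linComb 1 (-1) (ψ p.1) (ψ p.2)) A =ᵐ[P]
        ⇑(F p.1) - ⇑(F p.2) := by
      intro p
      filter_upwards [hL.simpleStochInt_linComb 1 (-1) (hψ p.1) (hψ p.2) hA,
        (hLp p.1).coeFn_toLp, (hLp p.2).coeFn_toLp] with ω h h1 h2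
      rw [Pi.sub_apply, h1, h2, h]
      ring
    refine Tendsto.congr (fun p => eLpNorm_congr_ae (hD p)) ?_
    have hmom' := fun p : ℕ × ℕ => hL.moments_simpleStochInt hmom
      (SimpleFunc.isBounded_support_linComb 1 (-1) (hψ p.1) (hψ p.2)) hA
    refine tendsto_eLpNorm_of_tendsto_integral_pow (k := 4) (by norm_num) (by decide)
      (fun p => by exact_mod_cast (hmom' p).1) ?_
    -- The fourth moment of a difference involves only its `L²` and `L⁴` norms, both of which tend
    -- to zero.
    simp_rw [fun p => (hmom' p).2.2.2]
    have ht : ∀ {u : ℕ → ℝ}, Tendsto u atTop (𝓝 0) →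
        Tendsto (fun p : ℕ × ℕ => u p.1 + u p.2) atTop (𝓝 0) := fun hu => by
      rw [← prod_atTop_atTop_eq]
      simpa using (hu.comp tendsto_fst).add (hu.comp tendsto_snd)
    have t2 : Tendsto (fun p : ℕ × ℕ =>
        ∫ z in A, SimpleFunc.linComb 1 (-1) (ψ p.1) (ψ p.2) z ^ 2) atTop (𝓝 0) := by
      refine squeeze_zero (fun p => integral_nonneg fun z => sq_nonneg _)
        (fun p => hsub p.1 p.2 two_ne_zero even_two hg2) ?_
      have h := (ht h2).const_mul (2 ^ (2 - 1) : ℝ)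
      rwa [mul_zero] at h
    have t4 : Tendsto (fun p : ℕ × ℕ =>
        ∫ z in A, SimpleFunc.linComb 1 (-1) (ψ p.1) (ψ p.2) z ^ 4) atTop (𝓝 0) := by
      refine squeeze_zero (fun p => integral_nonneg fun z => (by decide : Even 4).pow_nonneg _)
        (fun p => hsub p.1 p.2 four_ne_zero (by decide) hg4) ?_
      simpa using (ht h4).const_mul (2 ^ (4 - 1) : ℝ)
    have t := (((t2.const_mul κ₂).pow 2).const_mul 3).add (t4.const_mul κ₄)
    simpa using t
  obtain ⟨Z, hZ⟩ := cauchySeq_tendsto_of_complete hcauchy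
  refine ⟨Z, Lp.memLp Z, ?_⟩
  have h := (Lp.tendsto_Lp_iff_tendsto_eLpNorm' F Z).1 hZ
  refine h.congr fun n => eLpNorm_congr_ae ?_
  filter_upwards [(hLp n).coeFn_toLp] with ω hω
  simp only [Pi.sub_apply, hF, hω]

/-- Moments of the stochastic integral of a function in `L² ∩ L⁴`. -/
theorem moments_of_isStochInt (hL : IsLevyBasis P L) {κ₂ κ₄ : ℝ}
    (hmom : ∀ A, MeasurableSet A → Bornology.IsBounded A →
      HasSemigroupMoments (P.map (L A)) (volume A).toReal κ₂ κ₄)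
    {g : ℝ × ℝ → ℝ} (hg2 : MemLp g 2) (hg4 : MemLp g 4) {X : Ω → ℝ}
    (hX : IsStochInt P L g X) :
    MemLp X 4 P ∧ ∫ ω, X ω ∂P = 0 ∧ ∫ ω, X ω ^ 2 ∂P = κ₂ * ∫ z, g z ^ 2 ∧
      ∫ ω, X ω ^ 4 ∂P = 3 * (κ₂ * ∫ z, g z ^ 2) ^ 2 + κ₄ * ∫ z, g z ^ 4 := by
  obtain ⟨φ, hφ, hφg, hφA, hφX⟩ := hX
  obtain ⟨ψ, hψ, hψg, hψb⟩ := exists_simpleFunc_tendsto_ae hg2.1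
  have hψm : ∀ n, AEStronglyMeasurable (ψ n) (volume : Measure (ℝ × ℝ)) := fun n =>
    (ψ n).aestronglyMeasurable
  have hlim := fun {A : Set (ℝ × ℝ)} (hA : MeasurableSet A) =>
    hL.exists_tendsto_eLpNorm_simpleStochInt hmom hg2 hg4 hψ
      (tendsto_integral_pow_sub hψm two_ne_zero hg2 hψg hψb)
      (tendsto_integral_pow_sub hψm four_ne_zero hg4 hψg hψb) hA
  have hLp : ∀ n {A}, MeasurableSet A → MemLp (simpleStochInt L (ψ n) A) 4 P := fun n _ hA =>
    (hL.moments_simpleStochInt hmom (hψ n) hA).1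
  obtain ⟨Z, hZ, hψZ⟩ := hlim .univ
  have hψZ' := tendstoInMeasure_of_tendsto_eLpNorm (by norm_num) (fun n => (hLp n .univ).1) hZ.1 hψZ
  have hdiff : ∀ {A}, MeasurableSet A → ∀ {Y Z : Ω → ℝ},
      TendstoInMeasure P (fun n => simpleStochInt L (φ n) A) atTop Y →
      TendstoInMeasure P (fun n => simpleStochInt L (ψ n) A) atTop Z →
      TendstoInMeasure P (fun n => simpleStochInt L (SimpleFunc.linComb 1 (-1) (φ n) (ψ n)) A) atTop
        (fun ω => 1 * Y ω + (-1) * Z ω) := fun {A} hA {Y Z} hY hZ =>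
    (hY.linComb hZ 1 (-1)).congr_left fun n =>
      (hL.simpleStochInt_linComb 1 (-1) (hφ n) (hψ n) hA).symm
  -- The sequence `φ` defining `X` is not dominated, whereas `ψ` is. Their difference tends to zero
  -- almost everywhere and its integrals converge over every Borel set, so `X` equals the `L⁴` limit
  -- `Z`.
  have hXZ := hL.ae_eq_zero_of_tendstoInMeasure hmom
    (fun n => SimpleFunc.isBounded_support_linComb 1 (-1) (hφ n) (hψ n))
    (by
      filter_upwards [hφg, hψg] with z h1 h2
      simpa using (h1.const_mul 1).add (h2.const_mul (-1)))
    (fun A hA => by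
      obtain ⟨Y, hY⟩ := hφA A hA
      obtain ⟨Z, hZ, hψZ⟩ := hlim hA
      exact ⟨_, hdiff hA hY
        (tendstoInMeasure_of_tendsto_eLpNorm (by norm_num) (fun n => (hLp n hA).1) hZ.1 hψZ)⟩)
    (hdiff .univ hφX hψZ')
  have hXZ' : X =ᵐ[P] Z := by
    filter_upwards [hXZ] with ω hω
    simp only [Pi.zero_apply] at hω
    linarith
  have hmomψ := fun n => hL.moments_simpleStochInt hmom (hψ n) .univ
  simp only [Measure.restrict_univ] at hmomψ
  have hlow : ∀ {p : ENNReal}, p ≤ 4 →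
      Tendsto (fun n => eLpNorm (simpleStochInt L (ψ n) Set.univ - Z) p P) atTop (𝓝 0) :=
    fun hp => tendsto_of_tendsto_of_tendsto_of_le_of_le tendsto_const_nhds hψZ (fun _ => zero_le)
      fun n => eLpNorm_le_eLpNorm_of_exponent_le hp ((hLp n .univ).1.sub hZ.1)
  have c2 := tendsto_integral_pow hψm two_ne_zero hg2 hψg hψb
  have c4 := tendsto_integral_pow hψm four_ne_zero hg4 hψg hψb
  have m1 := tendsto_integral_of_L1' Z hZ.1
    (.of_forall fun n => (hLp n .univ).integrable (by norm_num)) (hlow (by norm_num))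
  have m2 := tendsto_integral_pow_of_tendsto_eLpNorm (k := 2) two_ne_zero even_two
    (fun n => (hLp n .univ).mono_exponent (by norm_num)) (hZ.mono_exponent (by norm_num))
    (hlow (by norm_num))
  have m4 := tendsto_integral_pow_of_tendsto_eLpNorm (k := 4) four_ne_zero (by decide)
    (fun n => hLp n .univ) hZ hψZ
  simp_rw [fun n => (hmomψ n).2.1] at m1
  simp_rw [fun n => (hmomψ n).2.2.1] at m2
  simp_rw [fun n => (hmomψ n).2.2.2] at m4
  refine ⟨(memLp_congr_ae hXZ').2 hZ, ?_, ?_, ?_⟩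
  · rw [integral_congr_ae hXZ']
    exact tendsto_nhds_unique m1 tendsto_const_nhds
  · rw [show ∫ ω, X ω ^ 2 ∂P = ∫ ω, Z ω ^ 2 ∂P from integral_congr_ae (hXZ'.fun_comp (· ^ 2))]
    exact tendsto_nhds_unique m2 (c2.const_mul κ₂)
  · rw [show ∫ ω, X ω ^ 4 ∂P = ∫ ω, Z ω ^ 4 ∂P from integral_congr_ae (hXZ'.fun_comp (· ^ 4))]
    exact tendsto_nhds_unique m4 ((((c2.const_mul κ₂).pow 2).const_mul 3).add (c4.const_mul κ₄))

end IsLevyBasis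

/-- Combining the two approximating sequences works directly, with no moment assumption. This is
what makes polarization available. -/
theorem IsStochInt.linComb {Ω : Type*} [MeasurableSpace Ω] {P : Measure Ω}
    {L : Set (ℝ × ℝ) → Ω → ℝ} (hL : IsLevyBasis P L) {g h : ℝ × ℝ → ℝ} {X Y : Ω → ℝ}
    (hX : IsStochInt P L g X) (hY : IsStochInt P L h Y) (a b : ℝ) :
    IsStochInt P L (fun z => a * g z + b * h z) (fun ω => a * X ω + b * Y ω) := by
  obtain ⟨φ, hφ, hφg, hφA, hφX⟩ := hX
  obtain ⟨ψ, hψ, hψh, hψA, hψY⟩ := hY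
  have hcomb : ∀ {A}, MeasurableSet A → ∀ {Y Z : Ω → ℝ},
      TendstoInMeasure P (fun n => simpleStochInt L (φ n) A) atTop Y →
      TendstoInMeasure P (fun n => simpleStochInt L (ψ n) A) atTop Z →
      TendstoInMeasure P (fun n => simpleStochInt L (SimpleFunc.linComb a b (φ n) (ψ n)) A) atTop
        (fun ω => a * Y ω + b * Z ω) := fun {A} hA {Y Z} hY hZ =>
    (hY.linComb hZ a b).congr_left fun n =>
      (hL.simpleStochInt_linComb a b (hφ n) (hψ n) hA).symm
  refine ⟨fun n => SimpleFunc.linComb a b (φ n) (ψ n),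
    fun n => SimpleFunc.isBounded_support_linComb a b (hφ n) (hψ n), ?_, fun A hA => ?_,
    hcomb .univ hφX hψY⟩
  · filter_upwards [hφg, hψh] with z h1 h2
    exact (h1.const_mul a).add (h2.const_mul b)
  · obtain ⟨Y, hY⟩ := hφA A hA
    obtain ⟨Z, hZ⟩ := hψA A hA
    exact ⟨_, hcomb hA hY hZ⟩

/-! ### Polarization -/

section Polarization

variable {α : Type*} [MeasurableSpace α] {μ : Measure α} {u₁ u₂ u₃ u₄ : α → ℝ}

theorem four_mul_integral_mul (h₁ : MemLp u₁ 2 μ) (h₂ : MemLp u₂ 2 μ) :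
    4 * ∫ x, u₁ x * u₂ x ∂μ =
      ∫ x, (1 * u₁ x + 1 * u₂ x) ^ 2 ∂μ - ∫ x, (1 * u₁ x + (-1) * u₂ x) ^ 2 ∂μ := by
  have hi : ∀ a b : ℝ, Integrable (fun x => (a * u₁ x + b * u₂ x) ^ 2) μ := fun a b =>
    integrable_pow_of_memLp two_ne_zero ((h₁.const_mul a).add (h₂.const_mul b))
  rw [← integral_sub (hi _ _) (hi _ _), ← integral_const_mul]
  congr 1 with x
  ring

theorem integrable_linComb_pow_four (h₁ : MemLp u₁ 4 μ) (h₂ : MemLp u₂ 4 μ) (h₃ : MemLp u₃ 4 μ)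
    (h₄ : MemLp u₄ 4 μ) (a b c : ℝ) :
    Integrable (fun x => (1 * (1 * u₁ x + a * u₂ x) + 1 * (b * u₃ x + c * u₄ x)) ^ 4) μ :=
  integrable_pow_of_memLp four_ne_zero ((((h₁.const_mul 1).add (h₂.const_mul a)).const_mul 1).add
    (((h₃.const_mul b).add (h₄.const_mul c)).const_mul 1))

/-- Polarization of the fourth power: the product of four functions in `L⁴` is integrable, and its
integral is an alternating sum of integrals of fourth powers. -/
theorem integral_mul_four_eq (h₁ : MemLp u₁ 4 μ) (h₂ : MemLp u₂ 4 μ) (h₃ : MemLp u₃ 4 μ)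
    (h₄ : MemLp u₄ 4 μ) {I : ℝ → ℝ → ℝ → ℝ}
    (hI : ∀ a b c, I a b c =
      ∫ x, (1 * (1 * u₁ x + a * u₂ x) + 1 * (b * u₃ x + c * u₄ x)) ^ 4 ∂μ) :
    Integrable (fun x => u₁ x * u₂ x * u₃ x * u₄ x) μ ∧
    192 * ∫ x, u₁ x * u₂ x * u₃ x * u₄ x ∂μ =
      I 1 1 1 - I (-1) 1 1 - I 1 (-1) 1 - I 1 1 (-1) +
        I (-1) (-1) 1 + I (-1) 1 (-1) + I 1 (-1) (-1) - I (-1) (-1) (-1) := by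
  have hi := integrable_linComb_pow_four h₁ h₂ h₃ h₄
  set F : ℝ → ℝ → ℝ → α → ℝ := fun a b c x =>
    (1 * (1 * u₁ x + a * u₂ x) + 1 * (b * u₃ x + c * u₄ x)) ^ 4 with hF
  have hi' : ∀ a b c, Integrable (F a b c) μ := hi
  have hI' : ∀ a b c, I a b c = ∫ x, F a b c x ∂μ := hI
  have i1 := (hi' 1 1 1).sub (hi' (-1) 1 1)
  have i2 := i1.sub (hi' 1 (-1) 1)
  have i3 := i2.sub (hi' 1 1 (-1))
  have i4 := i3.add (hi' (-1) (-1) 1)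
  have i5 := i4.add (hi' (-1) 1 (-1))
  have i6 := i5.add (hi' 1 (-1) (-1))
  have i7 := i6.sub (hi' (-1) (-1) (-1))
  -- Summing `a b c (u₁ + a u₂ + b u₃ + c u₄)⁴` over the signs keeps only the monomial `u₁ u₂ u₃
  -- u₄`, with factor `2³ · 4! = 192`. The sign of `u₁` can be fixed because the power is even.
  have heq : ∀ x, (F 1 1 1 - F (-1) 1 1 - F 1 (-1) 1 - F 1 1 (-1) + F (-1) (-1) 1 + F (-1) 1 (-1) +
      F 1 (-1) (-1) - F (-1) (-1) (-1)) x = 192 * (u₁ x * u₂ x * u₃ x * u₄ x) := by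
    intro x
    simp only [Pi.sub_apply, Pi.add_apply, hF]
    ring
  constructor
  · refine (i7.const_mul 192⁻¹).congr (.of_forall fun x => ?_)
    simp only [heq]
    ring
  · rw [← integral_const_mul]
    simp_rw [← heq]
    rw [integral_sub' i6 (hi' _ _ _), integral_add' i5 (hi' _ _ _), integral_add' i4 (hi' _ _ _),
      integral_add' i3 (hi' _ _ _), integral_sub' i2 (hi' _ _ _), integral_sub' i1 (hi' _ _ _),
      integral_sub' (hi' _ _ _) (hi' _ _ _)]
    simp only [hI']

theorem integral_sum_sq {ι : Type*} [Fintype ι] {u : ι → α → ℝ} (hu : ∀ i, MemLp (u i) 2 μ)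
    (s : ι → ℝ) : ∫ x, (∑ i, s i * u i x) ^ 2 ∂μ =
      ∑ i, ∑ j, s i * s j * ∫ x, u i x * u j x ∂μ := by
  have hi : ∀ i j, Integrable (fun x => s i * s j * (u i x * u j x)) μ := fun i j =>
    ((hu i).integrable_mul (hu j)).const_mul _
  simp_rw [sq, Finset.sum_mul_sum]
  simp_rw [show ∀ i j x, s i * u i x * (s j * u j x) = s i * s j * (u i x * u j x) from
    fun i j x => by ring]
  rw [integral_finsetSum _ fun i _ => integrable_finsetSum _ fun j _ => hi i j]
  refine Finset.sum_congr rfl fun i _ => ?_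
  rw [integral_finsetSum _ fun j _ => hi i j]
  simp_rw [integral_const_mul]

end Polarization

namespace IsLevyBasis

variable {Ω : Type*} [MeasurableSpace Ω] {P : Measure Ω} [IsProbabilityMeasure P]
  {L : Set (ℝ × ℝ) → Ω → ℝ}

theorem integral_mul_of_isStochInt (hL : IsLevyBasis P L) {κ₂ κ₄ : ℝ}
    (hmom : ∀ A, MeasurableSet A → Bornology.IsBounded A →
      HasSemigroupMoments (P.map (L A)) (volume A).toReal κ₂ κ₄)
    {g₁ g₂ : ℝ × ℝ → ℝ} (h₁ : MemLp g₁ 2) (h₁' : MemLp g₁ 4) (h₂ : MemLp g₂ 2) (h₂' : MemLp g₂ 4)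
    {X₁ X₂ : Ω → ℝ} (hX₁ : IsStochInt P L g₁ X₁) (hX₂ : IsStochInt P L g₂ X₂) :
    ∫ ω, X₁ ω * X₂ ω ∂P = κ₂ * ∫ z, g₁ z * g₂ z := by
  have hX : ∀ {g : ℝ × ℝ → ℝ} {X : Ω → ℝ}, MemLp g 2 → MemLp g 4 → IsStochInt P L g X →
      MemLp X 2 P := fun hg hg' hX =>
    (hL.moments_of_isStochInt hmom hg hg' hX).1.mono_exponent (by norm_num)
  have hsq : ∀ a b : ℝ, ∫ ω, (a * X₁ ω + b * X₂ ω) ^ 2 ∂P =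
      κ₂ * ∫ z, (a * g₁ z + b * g₂ z) ^ 2 := fun a b =>
    (hL.moments_of_isStochInt hmom ((h₁.const_mul a).add (h₂.const_mul b))
      ((h₁'.const_mul a).add (h₂'.const_mul b)) (hX₁.linComb hL hX₂ a b)).2.2.1
  have hp := four_mul_integral_mul (hX h₁ h₁' hX₁) (hX h₂ h₂' hX₂)
  have hv := four_mul_integral_mul h₁ h₂
  rw [hsq, hsq] at hp
  linear_combination (1 / 4) * hp - (κ₂ / 4) * hv

/-- The same polarization is applied to the variables and to the kernels. The `κ₄` parts correspond,
and the squared quadratic form leaves the Wick sum over the three pairings. -/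
theorem integral_mul_four_of_isStochInt (hL : IsLevyBasis P L) {κ₂ κ₄ : ℝ}
    (hmom : ∀ A, MeasurableSet A → Bornology.IsBounded A →
      HasSemigroupMoments (P.map (L A)) (volume A).toReal κ₂ κ₄)
    {g : Fin 4 → ℝ × ℝ → ℝ} (hg : ∀ i, MemLp (g i) 2) (hg' : ∀ i, MemLp (g i) 4)
    {X : Fin 4 → Ω → ℝ} (hX : ∀ i, IsStochInt P L (g i) (X i)) {G : Fin 4 → Fin 4 → ℝ}
    (hG : ∀ i j, G i j = κ₂ * ∫ z, g i z * g j z) :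
    Integrable (fun ω => X 0 ω * X 1 ω * X 2 ω * X 3 ω) P ∧
    ∫ ω, X 0 ω * X 1 ω * X 2 ω * X 3 ω ∂P =
      G 0 1 * G 2 3 + G 0 2 * G 1 3 + G 0 3 * G 1 2 +
        κ₄ * ∫ z, g 0 z * g 1 z * g 2 z * g 3 z := by
  have hXL : ∀ i, MemLp (X i) 4 P := fun i =>
    (hL.moments_of_isStochInt hmom (hg i) (hg' i) (hX i)).1
  obtain ⟨hint, hp⟩ := integral_mul_four_eq (hXL 0) (hXL 1) (hXL 2) (hXL 3) (fun _ _ _ => rfl)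
  refine ⟨hint, ?_⟩
  obtain ⟨-, hv⟩ := integral_mul_four_eq (hg' 0) (hg' 1) (hg' 2) (hg' 3) (fun _ _ _ => rfl)
  have hsymm : ∀ i j, G i j = G j i := fun i j => by
    rw [hG, hG]; simp_rw [mul_comm (g i _)]
  have hsq : ∀ a b c : ℝ,
      κ₂ * ∫ z, (1 * (1 * g 0 z + a * g 1 z) + 1 * (b * g 2 z + c * g 3 z)) ^ 2 =
      G 0 0 + a ^ 2 * G 1 1 + b ^ 2 * G 2 2 + c ^ 2 * G 3 3 + 2 * a * G 0 1 + 2 * b * G 0 2 +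
        2 * c * G 0 3 + 2 * a * b * G 1 2 + 2 * a * c * G 1 3 + 2 * b * c * G 2 3 := by
    intro a b c
    have h := integral_sum_sq hg ![1, a, b, c]
    have hfun : ∀ z, (1 * (1 * g 0 z + a * g 1 z) + 1 * (b * g 2 z + c * g 3 z)) =
        ∑ i, ![1, a, b, c] i * g i z := fun z => by
      simp [Fin.sum_univ_four]; ring
    simp_rw [hfun]
    rw [h, Finset.mul_sum]
    simp_rw [Finset.mul_sum, fun i j => show κ₂ * (![1, a, b, c] i * ![1, a, b, c] j *
      ∫ z, g i z * g j z) = ![1, a, b, c] i * ![1, a, b, c] j * G i j by rw [hG]; ring]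
    simp only [Fin.sum_univ_four, Matrix.cons_val]
    rw [hsymm 1 0, hsymm 2 0, hsymm 3 0, hsymm 2 1, hsymm 3 1, hsymm 3 2]
    ring
  have hfour : ∀ a b c : ℝ,
      ∫ ω, (1 * (1 * X 0 ω + a * X 1 ω) + 1 * (b * X 2 ω + c * X 3 ω)) ^ 4 ∂P =
      3 * (G 0 0 + a ^ 2 * G 1 1 + b ^ 2 * G 2 2 + c ^ 2 * G 3 3 + 2 * a * G 0 1 + 2 * b * G 0 2 +
        2 * c * G 0 3 + 2 * a * b * G 1 2 + 2 * a * c * G 1 3 + 2 * b * c * G 2 3) ^ 2 +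
      κ₄ * ∫ z, (1 * (1 * g 0 z + a * g 1 z) + 1 * (b * g 2 z + c * g 3 z)) ^ 4 := by
    intro a b c
    rw [← hsq]
    exact (hL.moments_of_isStochInt hmom
      (((((hg 0).const_mul 1).add ((hg 1).const_mul a)).const_mul 1).add
        ((((hg 2).const_mul b).add ((hg 3).const_mul c)).const_mul 1))
      (((((hg' 0).const_mul 1).add ((hg' 1).const_mul a)).const_mul 1).add
        ((((hg' 2).const_mul b).add ((hg' 3).const_mul c)).const_mul 1))
      (((hX 0).linComb hL (hX 1) 1 a).linComb hL ((hX 2).linComb hL (hX 3) b c) 1 1)).2.2.2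
  simp only [hfour] at hp
  -- In the sign sum of `3 Q²` only products such as `(2 a G₀₁) (2 b c G₂₃)` survive, each with
  -- total coefficient `3 · 8 · 8 = 192`.
  linear_combination (1 / 192) * hp - (κ₄ / 192) * hv

end IsLevyBasis

/-! ### Time reflection and conclusion -/

/-- The reflection `(x, s) ↦ (x, t - s)`. -/
def reflectSnd (t : ℝ) : ℝ × ℝ ≃ᵐ ℝ × ℝ :=
  (MeasurableEquiv.refl ℝ).prodCongr (MeasurableEquiv.subLeft t)

theorem measurePreserving_reflectSnd (t : ℝ) : MeasurePreserving (reflectSnd t) :=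
  (MeasurePreserving.id volume).prod (Measure.measurePreserving_sub_left volume t)

theorem integral_reflectSnd (t : ℝ) (h : ℝ × ℝ → ℝ) :
    ∫ z : ℝ × ℝ, h (z.1, t - z.2) = ∫ z, h z :=
  (measurePreserving_reflectSnd t).integral_comp (reflectSnd t).measurableEmbedding h

theorem mainTheorem5
    {Ω Ω' : Type*} [MeasurableSpace Ω] [MeasurableSpace Ω']
    (P : Measure Ω) [IsProbabilityMeasure P] (P' : Measure Ω') [IsProbabilityMeasure P']
    -- the homogeneous Lévy basis and its seed
    (ζ a : ℝ) (ν : Measure ℝ)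
    (L : Set (ℝ × ℝ) → Ω → ℝ) (hL : IsHomogeneousLevyBasis P L ζ a ν)
    (L' : Ω' → ℝ) (hL' : IsLevySeed P' L' ζ a ν)
    (hnonzero : ¬ (L' =ᵐ[P'] 0)) (hmean : ∫ ω, L' ω ∂P' = 0) (hfourth : MemLp L' 4 P')
    (κ₂ η κ₄ : ℝ) (hκ₂ : κ₂ = ∫ ω, L' ω ^ 2 ∂P') (hη : η = (∫ ω, L' ω ^ 4 ∂P') / κ₂ ^ 2)
    (hκ₄ : κ₄ = (η - 3) * κ₂ ^ 2)
    -- the kernel and the process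
    (f : ℝ × ℝ → ℝ) (hf2 : MemLp f 2 volume) (hf4 : MemLp f 4 volume)
    (Y : ℝ → Ω → ℝ) (hY : IsMMAP P L f Y)
    -- the autocovariance function
    (γ : ℝ → ℝ) (hγ : ∀ h, γ h = cov[Y 0, Y h; P]) :
    (∀ t, MemLp (Y t) 4 P) ∧
    (∀ h, γ h = κ₂ * ∫ z : ℝ × ℝ, f (z.1, -z.2) * f (z.1, h - z.2)) ∧
    ∀ t₁ t₂ t₃ t₄ : ℝ,
      Integrable (fun ω => Y t₁ ω * Y t₂ ω * Y t₃ ω * Y t₄ ω) P ∧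
      ∫ ω, Y t₁ ω * Y t₂ ω * Y t₃ ω * Y t₄ ω ∂P =
        γ (t₁ - t₂) * γ (t₃ - t₄) + γ (t₁ - t₃) * γ (t₂ - t₄) + γ (t₁ - t₄) * γ (t₂ - t₃) +
          κ₄ * ∫ z : ℝ × ℝ, f (z.1, t₁ - t₃ + z.2) * f (z.1, t₂ - t₃ + z.2) *
            f (z.1, z.2) * f (z.1, t₄ - t₃ + z.2) := by
  -- A nonzero variance allows `κ₂ ^ 2` to be cancelled in `η`, so that `κ₄` is the fourth cumulant
  -- of the seed.
  have hκ₂0 : κ₂ ≠ 0 := by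
    intro h0
    refine hnonzero ?_
    have h := (integral_eq_zero_iff_of_nonneg (fun ω => sq_nonneg (L' ω))
      (hfourth.integrable_pow_of_le_four (by norm_num))).1 (hκ₂ ▸ h0)
    filter_upwards [h] with ω hω
    simpa using hω
  have hκ₄' : κ₄ = ∫ ω, L' ω ^ 4 ∂P' - 3 * κ₂ ^ 2 := by
    rw [hκ₄, hη, sub_mul, div_mul_cancel₀ _ (pow_ne_zero 2 hκ₂0)]
  have hmom := hL.hasSemigroupMoments hL' hmean hfourth hκ₂ hκ₄'
  have hB := hL.toIsLevyBasis
  have hg2 : ∀ t : ℝ, MemLp (fun z : ℝ × ℝ => f (z.1, t - z.2)) 2 := fun t =>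
    hf2.comp_measurePreserving (measurePreserving_reflectSnd t)
  have hg4 : ∀ t : ℝ, MemLp (fun z : ℝ × ℝ => f (z.1, t - z.2)) 4 := fun t =>
    hf4.comp_measurePreserving (measurePreserving_reflectSnd t)
  have hYmom := fun t => hB.moments_of_isStochInt hmom (hg2 t) (hg4 t) (hY t)
  have hγ' : ∀ h, γ h = κ₂ * ∫ z : ℝ × ℝ, f (z.1, -z.2) * f (z.1, h - z.2) := by
    intro h
    rw [hγ, covariance, (hYmom 0).2.1, (hYmom h).2.1]
    simp only [sub_zero]
    rw [hB.integral_mul_of_isStochInt hmom (hg2 0) (hg4 0) (hg2 h) (hg4 h) (hY 0) (hY h)]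
    simp only [zero_sub]
  have hγ'' : ∀ s t, γ (s - t) =
      κ₂ * ∫ z : ℝ × ℝ, f (z.1, s - z.2) * f (z.1, t - z.2) := by
    intro s t
    -- The reflections about `0` and `t` together amount to a shift by `t`.
    rw [hγ', ← integral_reflectSnd 0, ← integral_reflectSnd t]
    congr 2 with z
    rw [mul_comm]
    congr 3 <;> ring
  refine ⟨fun t => (hYmom t).1, hγ', fun t₁ t₂ t₃ t₄ => ?_⟩
  have h := hB.integral_mul_four_of_isStochInt hmom
    (g := fun i z => f (z.1, ![t₁, t₂, t₃, t₄] i - z.2)) (fun i => hg2 _) (fun i => hg4 _)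
    (X := fun i => Y (![t₁, t₂, t₃, t₄] i)) (fun i => hY _)
    (G := fun i j => γ (![t₁, t₂, t₃, t₄] i - ![t₁, t₂, t₃, t₄] j)) (fun i j => hγ'' _ _)
  simp only [Matrix.cons_val] at h
  refine ⟨h.1, h.2.trans ?_⟩
  congr 2
  -- Replacing `s` by `t₃ - s` exchanges the kernels `f (x, tᵢ - s)` and `f (x, tᵢ - t₃ + s)`.
  rw [← integral_reflectSnd t₃]
  congr 1 with z
  congr <;> ring
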